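/- Let $\mathcal S$ be a Borel subset of a finite-dimensional Euclidean space (e.g. $[0,\infty)$ or $\mathbb R^2$), let $R\subseteq\mathcal S$ be a bounded Borel set, and let $R_1,\dots,R_d$ be a partition of $R$ into Borel sets. For $t=1,2,\dots$ let $X_t$ be a locally finite point process on $\mathcal S$ (a random countable subset), and let $\Lambda_t=\{\Lambda_t(s)\}_{s\in\mathcal S}$ be a jointly measurable positive random function that is integrable over bounded Borel sets. Assume: A1. Given the whole family $(\Lambda_t)_{t\ge 1}$, the $X_t$ are independent and each $X_t$ is a Poisson process with intensity function $\Lambda_t$ (that is, the number of points in a bounded Borel set $B$ is Poisson with rate $\int_B\Lambda_t(s)\,ds$, and the numbers of points in disjoint bounded Borel sets are independent); moreover $\{\log\Lambda_t(s)\}_{t\ge 1,\,s\in\mathcal S}$ is a Gaussian process, stationary in $t$, with $E\{\log\Lambda_t(s)\}=\mu(s)$ and $\mathrm{cov}\{\log\Lambda_t(s),\log\Lambda_{t+k}(s')\}=\gamma_k(s,s')$ for $k\in\mathbb Z$, not depending on $t$. A2. $\sup_{s\in R}|\mu(s)|<\infty$, $\|\gamma_k\|_\infty:=\sup_{s,s'\in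 R}|\gamma_k(s,s')|<\infty$ for all $k$, and $\|\gamma_k\|_\infty\to 0$ as $k\to+\infty$. Let $\mathbf Y_t$ be the vector of bin counts $Y_{tj}=\#(X_t\cap R_j)$, $j=1,\dots,d$, and put $$\hat{\boldsymbol\nu}=\bar{\mathbf Y}=\frac1n\sum_{t=1}^n\mathbf Y_t,\qquad \hat{\mathbf C}_0=\frac1n\sum_{t=1}^n\mathbf Y_t\mathbf Y_t^T-\mathrm{diag}(\bar{\mathbf Y}),\qquad \hat{\mathbf C}_k=\frac1{n-k}\sum_{t=1}^{n-k}\mathbf Y_t\mathbf Y_{t+k}^T\quad(k\ge1).$$ Then $\nu(s)=E\{\Lambda_t(s)\}$ and $c_k(s,s')=E\{\Lambda_t(s)\Lambda_{t+k}(s')\}$, $k\ge 0$, are finite and do not depend on $t$, they are integrable over $R_j$ and $R_j\times R_{j'}$ respectively, and: 1. $\hat{\boldsymbol\nu}\to\boldsymbol\nu$ in probability as $n\to\infty$, where $\boldsymbol\nu=E(\mathbf Y_t)$ (for every $t$) is the vector with entries $\nu_j=\int_{R_j}\nu(s)\,ds$; 2. for every $k\ge0$, $\hat{\mathbf C}_k\to\mathbf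 C_k$ in probability as $n\to\infty$, where $\mathbf C_k$ is the $d\times d$ matrix with entries $C_{k,jj'}=\iint_{R_j\times R_{j'}}c_k(s,s')\,ds\,ds'$. -/

import Mathlib

open MeasureTheory ProbabilityTheory Filter Topology
open scoped ENNReal NNReal Matrix.Norms.Elementwise

namespace CoxSeries

noncomputable section

/-- The number `N(B) = #(X ∩ B)` of points of a random set `X` in the region `B`. -/
def count {Ω E : Type*} (X : Ω → Set E) (B : Set E) (ω : Ω) : ℕ :=
  (X ω ∩ B).ncard

/-- `X` is a locally finite point process in the space `S`: a random countable subset of `S` that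
has almost surely finitely many points in every bounded Borel set, and whose counts are random
variables. -/
structure IsPointProcess {Ω E : Type*} [MeasurableSpace Ω] [PseudoMetricSpace E]
    [MeasurableSpace E] (P : Measure Ω) (S : Set E) (X : Ω → Set E) : Prop where
  subset : ∀ ω, X ω ⊆ S
  countable : ∀ ω, (X ω).Countable
  locally_finite : ∀ B ⊆ S, Bornology.IsBounded B → MeasurableSet B →
    ∀ᵐ ω ∂P, (X ω ∩ B).Finite
  measurable_count : ∀ B ⊆ S, Bornology.IsBounded B → MeasurableSet B →
    Measurable (count X B)

/-- The `σ`-algebra generated by a point process, i.e. by all its counts in bounded Borel sets. -/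
@[reducible] def sigmaPoints {Ω E : Type*} [PseudoMetricSpace E] [MeasurableSpace E]
    (S : Set E) (X : Ω → Set E) : MeasurableSpace Ω :=
  ⨆ (B : Set E) (_ : B ⊆ S ∧ Bornology.IsBounded B ∧ MeasurableSet B),
    MeasurableSpace.comap (count X B) ⊤

/-- The `σ`-algebra generated by the whole family of random functions `Λ t`, `t = 0, 1, 2, …`,
on `S`. -/
@[reducible] def sigmaIntensity {Ω E : Type*} (S : Set E) (Λ : ℕ → Ω → E → ℝ) : MeasurableSpace Ω :=
  ⨆ (t : ℕ) (s : S), MeasurableSpace.comap (fun ω => Λ t ω s) (borel ℝ)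

/-- Conditional independence, given `𝒢`, of a family `m` of `σ`-algebras. On a standard Borel
space this is `ProbabilityTheory.iCondIndep` (see `ProbabilityTheory.iCondIndep_iff`); the form
below makes sense on every probability space. -/
def CondIndepGiven {Ω ι : Type*} (𝒢 : MeasurableSpace Ω) [MeasurableSpace Ω] (P : Measure Ω)
    (m : ι → MeasurableSpace Ω) : Prop :=
  ∀ (T : Finset ι) (A : ι → Set Ω), (∀ i ∈ T, MeasurableSet[m i] (A i)) →
    P⟦⋂ i ∈ T, A i | 𝒢⟧ =ᵐ[P] ∏ i ∈ T, P⟦A i | 𝒢⟧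

/-- Conditionally on `𝒢`, the point process `X` is a Poisson process on `S` with the (random,
nonnegative) intensity function `lam`: given `𝒢`, the count in a bounded Borel set `B` is Poisson
with rate `∫_B lam`, and the counts in finitely many disjoint bounded Borel sets are
independent. -/
structure IsPoissonGiven {Ω E : Type*} (𝒢 : MeasurableSpace Ω) [MeasurableSpace Ω]
    [PseudoMetricSpace E] [MeasureSpace E] (P : Measure Ω) (S : Set E)
    (X : Ω → Set E) (lam : Ω → E → ℝ) : Prop where
  poisson_count : ∀ B ⊆ S, Bornology.IsBounded B → MeasurableSet B → ∀ n : ℕ,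
    P⟦{ω | count X B ω = n} | 𝒢⟧ =ᵐ[P]
      fun ω => (poissonMeasure (∫ s in B, lam ω s).toNNReal).real {n}
  indep_count : ∀ (m : ℕ) (B : Fin m → Set E), (∀ i, B i ⊆ S) →
    (∀ i, Bornology.IsBounded (B i)) → (∀ i, MeasurableSet (B i)) →
    Pairwise (Function.onFun Disjoint B) →
    CondIndepGiven 𝒢 P (fun i => MeasurableSpace.comap (count X (B i)) ⊤)

/-- Assumption A1: `(X t, Λ t)`, `t = 0, 1, 2, …`, is a time series of Cox processes on `S`,
conditionally independent and Poisson with intensities `Λ t` given all the `Λ`s, with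
`log Λ` a stationary Gaussian process with mean `μ` and autocovariances `γ k`. -/
structure AssumptionA1 {Ω E : Type*} [MeasurableSpace Ω] [PseudoMetricSpace E] [MeasureSpace E]
    (P : Measure Ω) (S : Set E) (X : ℕ → Ω → Set E) (Λ : ℕ → Ω → E → ℝ)
    (μ : E → ℝ) (γ : ℤ → E → E → ℝ) : Prop where
  pointProcess : ∀ t, IsPointProcess P S (X t)
  pos : ∀ t ω, ∀ s ∈ S, 0 < Λ t ω s
  measurable : ∀ t, Measurable (fun p : Ω × S => Λ t p.1 p.2)
  locally_integrable : ∀ t ω, ∀ B ⊆ S, Bornology.IsBounded B → MeasurableSet B →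
    IntegrableOn (Λ t ω) B
  poisson : ∀ t, IsPoissonGiven (sigmaIntensity S Λ) P S (X t) (Λ t)
  condIndep : CondIndepGiven (sigmaIntensity S Λ) P (fun t => sigmaPoints S (X t))
  gaussian : IsGaussianProcess (fun (p : ℕ × S) ω => Real.log (Λ p.1 ω p.2)) P
  mean : ∀ t, ∀ s ∈ S, ∫ ω, Real.log (Λ t ω s) ∂P = μ s
  autocov : ∀ t u : ℕ, ∀ s ∈ S, ∀ s' ∈ S,
    cov[fun ω => Real.log (Λ t ω s), fun ω => Real.log (Λ u ω s'); P] =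
      γ ((u : ℤ) - (t : ℤ)) s s'

/-- The supremum norm of `f` over the set `A`, with values in `[0, ∞]`. -/
def supNorm {α : Type*} (f : α → ℝ) (A : Set α) : ℝ≥0∞ :=
  ⨆ x ∈ A, ‖f x‖ₑ

/-- Assumption A2. -/
structure AssumptionA2 {E : Type*} (R : Set E) (μ : E → ℝ) (γ : ℤ → E → E → ℝ) : Prop where
  mean_bounded : supNorm μ R < ∞
  autocov_bounded : ∀ k : ℤ, supNorm (fun p : E × E => γ k p.1 p.2) (R ×ˢ R) < ∞
  autocov_tendsto :
    Tendsto (fun k : ℤ => supNorm (fun p : E × E => γ k p.1 p.2) (R ×ˢ R)) atTop (𝓝 0)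

/-- The mean intensity `ν(s) = E Λ_t(s)`, computed at the first time. -/
def nu {Ω E : Type*} [MeasurableSpace Ω] (P : Measure Ω) (Λ : ℕ → Ω → E → ℝ) (s : E) : ℝ :=
  ∫ ω, Λ 0 ω s ∂P

/-- The second moments `c_k(s, s') = E {Λ_t(s) Λ_{t+k}(s')}`, computed at the first time. -/
def c {Ω E : Type*} [MeasurableSpace Ω] (P : Measure Ω) (Λ : ℕ → Ω → E → ℝ) (k : ℕ)
    (s s' : E) : ℝ :=
  ∫ ω, Λ 0 ω s * Λ k ω s' ∂P

/-- The vector `Y_t` of bin counts. -/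
def binCounts {Ω E : Type*} {d : ℕ} (X : ℕ → Ω → Set E) (Rb : Fin d → Set E)
    (t : ℕ) (ω : Ω) : Fin d → ℝ :=
  fun j => (count (X t) (Rb j) ω : ℝ)

/-- The sample mean of the first `n` bin-count vectors. -/
def nuHat {Ω : Type*} {d : ℕ} (Y : ℕ → Ω → Fin d → ℝ) (n : ℕ) (ω : Ω) : Fin d → ℝ :=
  (1 / (n : ℝ)) • ∑ t ∈ Finset.range n, Y t ω

/-- The sample second-moment matrix of lag `k` of the first `n` bin-count vectors (meaningful for
`n > k`), with the diagonal correction at `k = 0`. -/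
def CHat {Ω : Type*} {d : ℕ} (Y : ℕ → Ω → Fin d → ℝ) (k n : ℕ) (ω : Ω) :
    Matrix (Fin d) (Fin d) ℝ :=
  (1 / ((n - k : ℕ) : ℝ)) •
      ∑ t ∈ Finset.range (n - k), Matrix.vecMulVec (Y t ω) (Y (t + k) ω)
    - if k = 0 then Matrix.diagonal (nuHat Y n ω) else 0

/-- The vector with entries `∫_{R_j} ν`. -/
def nuVec {Ω E : Type*} [MeasurableSpace Ω] [MeasureSpace E] {d : ℕ} (P : Measure Ω)
    (Λ : ℕ → Ω → E → ℝ) (Rb : Fin d → Set E) : Fin d → ℝ :=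
  fun j => ∫ s in Rb j, nu P Λ s

/-- The matrix with entries `∬_{R_j × R_{j'}} c_k`. -/
def CMat {Ω E : Type*} [MeasurableSpace Ω] [MeasureSpace E] {d : ℕ} (P : Measure Ω)
    (Λ : ℕ → Ω → E → ℝ) (Rb : Fin d → Set E) (k : ℕ) : Matrix (Fin d) (Fin d) ℝ :=
  Matrix.of fun j j' => ∫ p in Rb j ×ˢ Rb j', c P Λ k p.1 p.2 ∂(volume.prod volume)

end

end CoxSeries

/-! Given all intensities, the bin counts `Y_{tj}` are independent Poisson variables whose rates are
the masses `∫_{R_j} Λ_t`. The `m`-th factorial moment of a Poisson law of rate `r` is `r ^ m`, so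
every mixed factorial moment of the counts equals the corresponding mixed moment of the masses
(`lintegral_prod_descFactorial`). This explains the diagonal correction in `CHat`: `Y² - Y` is the
second factorial power of `Y`, so each entry of both estimators is a time average of one factorial
monomial `Z_t`.

By Tonelli a mixed moment of masses is an integral of `E ∏ Λ_{t i}(s i)`, and the Gaussian
assumption makes that expectation `exp (logMoment)`. Three facts follow. Times enter only through
differences, so `E Z_t` is constant. The bounds in A2 and the boundedness of `R` make all moments of
the masses finite. The moment of two groups of factors is the product of their moments times the
exponential of the sum of the cross covariances, so `E Z_t Z_u ≤ (E Z_0)² + ε` once `u - t` is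
large.

Constant mean, bounded second moments and this asymptotic bound give a weak law of large numbers
through Chebyshev's inequality (`tendstoInMeasure_average`). The limits are then identified with the
integrals of `ν` and `c_k`, again by Tonelli. -/

namespace MeasureTheory

/-! ### Product integrals and convergence in measure -/

/-- Tonelli's theorem for a product of functions of separate variables indexed by `Fin n`. -/
theorem lintegral_fin_prod_eq_prod {n : ℕ} {E : Type*} {mE : MeasurableSpace E}
    {μ : Fin n → Measure E} [∀ i, SigmaFinite (μ i)] {f : Fin n → E → ℝ≥0∞}
    (hf : ∀ i, Measurable (f i)) :
    ∫⁻ x : Fin n → E, ∏ i, f i (x i) ∂(Measure.pi μ) = ∏ i, ∫⁻ x, f i x ∂(μ i) := by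
  induction n with
  | zero => simp
  | succ n ih =>
    have hpre := (measurePreserving_piFinSuccAbove μ 0).symm
    rw [← hpre.lintegral_comp_emb (MeasurableEquiv.measurableEmbedding _), Fin.prod_univ_succ,
      ← ih (fun i => hf i.succ), ← lintegral_prod_mul (hf 0).aemeasurable
        (Finset.measurable_fun_prod _ fun i _ =>
          (hf i.succ).comp (measurable_pi_apply i)).aemeasurable]
    simp only [MeasurableEquiv.piFinSuccAbove_symm_apply, Fin.insertNthEquiv, Fin.prod_univ_succ,
      Fin.insertNth_zero, Equiv.coe_fn_mk, Fin.cons_zero, Fin.cons_succ]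
    rfl

/-- Tonelli's theorem for a product of functions of finitely many separate variables. -/
theorem lintegral_fintype_prod_eq_prod {ι E : Type*} [Fintype ι] {mE : MeasurableSpace E}
    {μ : ι → Measure E} [∀ i, SigmaFinite (μ i)] {f : ι → E → ℝ≥0∞}
    (hf : ∀ i, Measurable (f i)) :
    ∫⁻ x : ι → E, ∏ i, f i (x i) ∂(Measure.pi μ) = ∏ i, ∫⁻ x, f i x ∂(μ i) := by
  let e := (Fintype.equivFin ι).symm
  rw [← (measurePreserving_piCongrLeft μ e).lintegral_comp_emb
    (MeasurableEquiv.measurableEmbedding _)]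
  simp_rw [← e.prod_comp, MeasurableEquiv.coe_piCongrLeft, Equiv.piCongrLeft_apply_apply]
  exact lintegral_fin_prod_eq_prod fun i => hf (e i)

/-- Coordinatewise convergence in measure implies convergence in measure in a finite product. -/
theorem tendstoInMeasure_pi {α κ ι : Type*} {m : MeasurableSpace α} {μ : Measure α} [Fintype ι]
    {F : ι → Type*} [∀ i, PseudoEMetricSpace (F i)]
    {l : Filter κ} {f : κ → α → ∀ i, F i} {g : α → ∀ i, F i}
    (h : ∀ i, TendstoInMeasure μ (fun n a => f n a i) l (fun a => g a i)) :
    TendstoInMeasure μ f l g := by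
  intro ε hε
  have hsum : Tendsto (fun n => ∑ i, μ {x | ε ≤ edist (f n x i) (g x i)}) l (𝓝 0) := by
    simpa using tendsto_finsetSum Finset.univ fun i _ => h i ε hε
  refine tendsto_of_tendsto_of_tendsto_of_le_of_le tendsto_const_nhds hsum (fun _ => zero_le)
    fun n => ?_
  refine le_trans (measure_mono fun x hx => ?_) (measure_iUnion_fintype_le μ _)
  simp only [Set.mem_iUnion]
  by_contra! hcon
  have hlt : edist (f n x) (g x) < ε := by
    rw [edist_pi_def, Finset.sup_lt_iff (by simpa using hε)]
    intro i _
    simpa using hcon i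
  exact absurd hx (by simpa using hlt)

end MeasureTheory

/-! ### Poisson factorial moments, a weak law, Gaussian exponential moments -/

namespace ProbabilityTheory

/-- The factorial moments of the Poisson distribution. -/
theorem lintegral_descFactorial_poissonMeasure (r : ℝ≥0) (m : ℕ) :
    ∫⁻ n, (n.descFactorial m : ℝ≥0∞) ∂(poissonMeasure r) = (r : ℝ≥0∞) ^ m := by
  have hterm (n : ℕ) : ((n + m).descFactorial m : ℝ≥0∞) * poissonMeasure r {n + m} =
      (r : ℝ≥0∞) ^ m * poissonMeasure r {n} := by
    rw [poissonMeasure_singleton, poissonMeasure_singleton, ← ENNReal.ofReal_natCast,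
      ← ENNReal.ofReal_coe_nnreal, ← ENNReal.ofReal_pow (by positivity),
      ← ENNReal.ofReal_mul (by positivity), ← ENNReal.ofReal_mul (by positivity)]
    congr 1
    have h := Nat.factorial_mul_descFactorial (Nat.le_add_left m n)
    rw [Nat.add_sub_cancel] at h
    have h' : ((n.factorial : ℝ)) * ((n + m).descFactorial m : ℝ) = ((n + m).factorial : ℝ) := by
      exact_mod_cast h
    have h1 : (n.factorial : ℝ) ≠ 0 := by positivity
    have h2 : ((n + m).descFactorial m : ℝ) ≠ 0 := by
      intro h0
      rw [h0, mul_zero] at h'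
      exact (Nat.cast_ne_zero.2 (Nat.factorial_ne_zero (n + m))) h'.symm
    rw [← h']
    field_simp
    ring
  -- The terms with `n < m` vanish; after the shift by `m` the rest is `r ^ m` times the total mass
  -- of the Poisson law.
  rw [lintegral_countable', ← ENNReal.summable.sum_add_tsum_nat_add' (k := m)]
  simp_rw [hterm]
  rw [ENNReal.tsum_mul_left, Finset.sum_eq_zero, zero_add]
  · have := lintegral_countable' (μ := poissonMeasure r) (fun _ => (1 : ℝ≥0∞))
    simp only [one_mul, lintegral_const, measure_univ] at this
    rw [← this, mul_one]
  · intro n hn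
    rw [Nat.descFactorial_of_lt (Finset.mem_range.1 hn)]
    simp

/-- A weak law of large numbers: square integrable variables with a common mean, bounded second
moments and asymptotically nonpositive correlations. -/
theorem tendstoInMeasure_average {Ω : Type*} [MeasurableSpace Ω] {P : Measure Ω}
    [IsProbabilityMeasure P] {Z : ℕ → Ω → ℝ} {c M : ℝ} (hZ : ∀ t, MemLp (Z t) 2 P)
    (hmean : ∀ t, ∫ ω, Z t ω ∂P = c) (hM : ∀ t, ∫ ω, Z t ω ^ 2 ∂P ≤ M)
    (hcorr : ∀ ε > 0, ∃ K : ℕ, ∀ t u, t + K ≤ u → ∫ ω, Z t ω * Z u ω ∂P ≤ c ^ 2 + ε) :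
    TendstoInMeasure P (fun (n : ℕ) ω => (1 / (n : ℝ)) * ∑ t ∈ Finset.range n, Z t ω) atTop
      (fun _ => c) := by
  have hM0 : 0 ≤ M := le_trans (integral_nonneg fun ω => sq_nonneg _) (hM 0)
  have hint (t u : ℕ) : Integrable (fun ω => Z t ω * Z u ω) P := (hZ t).integrable_mul (hZ u)
  have hint1 (t : ℕ) : Integrable (Z t) P := (hZ t).integrable (by norm_num)
  have hWint (t u : ℕ) : Integrable (fun ω => (Z t ω - c) * (Z u ω - c)) P :=
    ((hZ t).sub (memLp_const c)).integrable_mul ((hZ u).sub (memLp_const c))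
  have hW (t u : ℕ) : ∫ ω, (Z t ω - c) * (Z u ω - c) ∂P = ∫ ω, Z t ω * Z u ω ∂P - c ^ 2 := by
    have he : (fun ω => (Z t ω - c) * (Z u ω - c)) =
        fun ω => Z t ω * Z u ω - c * Z t ω - (c * Z u ω - c ^ 2) := by ext ω; ring
    have h1 : Integrable (fun ω => Z t ω * Z u ω - c * Z t ω) P :=
      (hint t u).sub ((hint1 t).const_mul c)
    have h2 : Integrable (fun ω => c * Z u ω - c ^ 2) P :=
      ((hint1 u).const_mul c).sub (integrable_const _)
    rw [he, integral_sub h1 h2, integral_sub (hint t u)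
      ((hint1 t).const_mul c), integral_sub ((hint1 u).const_mul c) (integrable_const _),
      integral_const_mul, integral_const_mul, hmean, hmean]
    simp
    ring
  have hWM (t u : ℕ) : ∫ ω, (Z t ω - c) * (Z u ω - c) ∂P ≤ M := by
    have h1 : ∫ ω, Z t ω * Z u ω ∂P ≤ ∫ ω, (Z t ω ^ 2 + Z u ω ^ 2) / 2 ∂P :=
      integral_mono (hint t u) (((hZ t).integrable_sq.add (hZ u).integrable_sq).div_const 2)
        fun ω => by nlinarith [sq_nonneg (Z t ω - Z u ω)]
    rw [integral_div, integral_add (hZ t).integrable_sq (hZ u).integrable_sq] at h1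
    rw [hW]
    nlinarith [hM t, hM u, sq_nonneg c]
  have key (ε : ℝ) (hε : 0 < ε) : ∃ K : ℕ, ∀ n : ℕ, 0 < n →
      ∫ ω, ((1 / (n : ℝ)) * ∑ t ∈ Finset.range n, Z t ω - c) ^ 2 ∂P ≤ ε + 2 * K * M / n := by
    obtain ⟨K, hK⟩ := hcorr ε hε
    refine ⟨K, fun n hn => ?_⟩
    have hn' : (0 : ℝ) < n := by exact_mod_cast hn
    have he : (fun ω => ((1 / (n : ℝ)) * ∑ t ∈ Finset.range n, Z t ω - c) ^ 2) =
        fun ω => (1 / (n : ℝ)) ^ 2 * ∑ t ∈ Finset.range n, ∑ u ∈ Finset.range n,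
          (Z t ω - c) * (Z u ω - c) := by
      ext ω
      rw [← Finset.sum_mul_sum, Finset.sum_sub_distrib]
      simp only [Finset.sum_const, Finset.card_range, nsmul_eq_mul]
      field_simp
    rw [he, integral_const_mul, integral_finsetSum _ fun t _ =>
      integrable_finsetSum _ fun u _ => hWint t u]
    -- Within distance `K` of the diagonal only the crude bound `M` is available. Each row has at
    -- most `2 * K` such entries, so after division by `n ^ 2` they contribute `2 * K * M / n`.
    have hb (t u : ℕ) : ∫ ω, (Z t ω - c) * (Z u ω - c) ∂P ≤
        ε + if u ∈ Finset.Ico (t - K) (t + K) then M else 0 := by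
      split_ifs with h
      · linarith [hWM t u]
      · rw [Finset.mem_Ico, not_and_or, not_le, not_lt] at h
        rcases h with h | h
        · have := hK u t (by omega)
          have hs := hW u t
          simp_rw [mul_comm (Z t _ - c)]
          linarith
        · linarith [hK t u h, hW t u]
    have hrow (t : ℕ) : ∑ u ∈ Finset.range n, ∫ ω, (Z t ω - c) * (Z u ω - c) ∂P ≤
        n * ε + 2 * K * M := by
      refine (Finset.sum_le_sum fun u _ => hb t u).trans ?_
      rw [Finset.sum_add_distrib, ← Finset.sum_filter]
      simp only [Finset.sum_const, Finset.card_range, nsmul_eq_mul]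
      gcongr
      have hc : ((Finset.range n).filter (· ∈ Finset.Ico (t - K) (t + K))).card ≤ 2 * K := by
        refine (Finset.card_le_card (t := Finset.Ico (t - K) (t + K)) fun x hx =>
          (Finset.mem_filter.1 hx).2).trans ?_
        rw [Nat.card_Ico]
        omega
      exact_mod_cast hc
    calc (1 / (n : ℝ)) ^ 2 * ∑ t ∈ Finset.range n,
          ∫ ω, ∑ u ∈ Finset.range n, (Z t ω - c) * (Z u ω - c) ∂P
        ≤ (1 / (n : ℝ)) ^ 2 * ∑ t ∈ Finset.range n, (n * ε + 2 * K * M) := by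
          gcongr with t _
          rw [integral_finsetSum _ fun u _ => hWint t u]
          exact hrow t
      _ = ε + 2 * K * M / n := by
          simp only [Finset.sum_const, Finset.card_range, nsmul_eq_mul]
          field_simp
  have hL2 : Tendsto (fun n : ℕ =>
      ∫ ω, ((1 / (n : ℝ)) * ∑ t ∈ Finset.range n, Z t ω - c) ^ 2 ∂P) atTop (𝓝 0) := by
    refine Metric.tendsto_atTop.2 fun ε hε => ?_
    obtain ⟨K, hK⟩ := key (ε / 2) (half_pos hε)
    have ht : Tendsto (fun n : ℕ => 2 * K * M / (n : ℝ)) atTop (𝓝 0) :=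
      tendsto_const_nhds.div_atTop tendsto_natCast_atTop_atTop
    obtain ⟨N, hN⟩ := eventually_atTop.1 (ht.eventually (gt_mem_nhds (half_pos hε)))
    refine ⟨max N 1, fun n hn => ?_⟩
    rw [Real.dist_eq, sub_zero, abs_of_nonneg (integral_nonneg fun ω => sq_nonneg _)]
    linarith [hK n (by omega), hN n (by omega)]
  rw [tendstoInMeasure_iff_measureReal_norm]
  intro δ hδ
  have hlim : Tendsto (fun n : ℕ => (∫ ω, ((1 / (n : ℝ)) * ∑ t ∈ Finset.range n, Z t ω - c) ^ 2 ∂P)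
      / δ ^ 2) atTop (𝓝 0) := by simpa using hL2.div_const (δ ^ 2)
  refine tendsto_of_tendsto_of_tendsto_of_le_of_le tendsto_const_nhds hlim
    (fun _ => measureReal_nonneg) fun n => ?_
  have hmem : MemLp (fun ω => (1 / (n : ℝ)) * ∑ t ∈ Finset.range n, Z t ω - c) 2 P :=
    ((memLp_finsetSum (Finset.range n) fun t _ => hZ t).const_mul _).sub (memLp_const c)
  have hcheb := mul_meas_ge_le_integral_of_nonneg (μ := P)
    (f := fun ω => ((1 / (n : ℝ)) * ∑ t ∈ Finset.range n, Z t ω - c) ^ 2)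
    (Eventually.of_forall fun ω => sq_nonneg _) hmem.integrable_sq (δ ^ 2)
  rw [le_div_iff₀ (by positivity), mul_comm]
  refine le_trans (mul_le_mul_of_nonneg_left (measureReal_mono fun ω hω => ?_) (sq_nonneg δ)) hcheb
  simp only [Set.mem_ofPred_eq] at hω ⊢
  rw [← sq_abs (_ - c)]
  exact pow_le_pow_left₀ hδ.le hω 2

/-- The expectation of `exp X` for a Gaussian variable `X`, with integrability. -/
theorem HasGaussianLaw.integrable_exp_and_integral_exp {Ω : Type*} [MeasurableSpace Ω]
    {P : Measure Ω} {X : Ω → ℝ} (hX : HasGaussianLaw X P) :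
    Integrable (fun ω => Real.exp (X ω)) P ∧
      ∫ ω, Real.exp (X ω) ∂P = Real.exp (∫ ω, X ω ∂P + Var[X; P] / 2) := by
  have h := mgf_gaussianReal hX.map_eq_gaussianReal 1
  simp only [mgf, one_mul, mul_one, one_pow, Real.coe_toNNReal _ (variance_nonneg X P)] at h
  refine ⟨?_, h⟩
  -- If `exp X` were not integrable, its integral would be `0` by convention, against the positive
  -- value given by the moment generating function.
  by_contra hni
  rw [integral_undef hni] at h
  exact (Real.exp_pos _).ne h

/-- The expectation of the exponential of a sum of values of a Gaussian process. -/
theorem IsGaussianProcess.integrable_exp_sum_and_integral {Ω T ι : Type*} [Fintype ι]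
    [MeasurableSpace Ω] {P : Measure Ω} {G : T → Ω → ℝ} (hG : IsGaussianProcess G P) (p : ι → T) :
    Integrable (fun ω => Real.exp (∑ i, G (p i) ω)) P ∧
      ∫ ω, Real.exp (∑ i, G (p i) ω) ∂P =
        Real.exp (∑ i, ∫ ω, G (p i) ω ∂P + (∑ i, ∑ j, cov[G (p i), G (p j); P]) / 2) := by
  have := hG.isProbabilityMeasure
  have hsum : HasGaussianLaw (fun ω => ∑ i, G (p i) ω) P :=
    (hG.comp_right p).hasGaussianLaw_fun_sum (I := Finset.univ)
  have h := hsum.integrable_exp_and_integral_exp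
  have hmem (i : ι) : MemLp (G (p i)) 2 P := (hG.hasGaussianLaw_eval (p i)).memLp_two
  rw [integral_finsetSum _ fun i _ => (hmem i).integrable (by norm_num),
    ← covariance_self hsum.aemeasurable, covariance_fun_sum_fun_sum hmem hmem] at h
  exact h

end ProbabilityTheory

/-! ### Mixed moments of the log-Gaussian intensities -/

namespace CoxSeries

/-- The logarithm of `E ∏ᵢ Λ_{t i}(s i)` for a log-Gaussian family `Λ`. -/
noncomputable def logMoment {E ι : Type*} [Fintype ι] (μ : E → ℝ) (γ : ℤ → E → E → ℝ)
    (t : ι → ℕ) (s : ι → E) : ℝ :=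
  ∑ i, μ (s i) + (∑ i, ∑ j, γ ((t j : ℤ) - (t i : ℤ)) (s i) (s j)) / 2

theorem logMoment_add_left {E ι : Type*} [Fintype ι] (μ : E → ℝ) (γ : ℤ → E → E → ℝ)
    (u : ℕ) (t : ι → ℕ) (s : ι → E) :
    logMoment μ γ (fun i => u + t i) s = logMoment μ γ t s := by
  unfold logMoment
  push_cast
  simp only [add_sub_add_left_eq_sub]

section

variable {Ω E : Type*} [MeasurableSpace Ω] [PseudoMetricSpace E] [MeasureSpace E]
  {P : Measure Ω} {S : Set E} {X : ℕ → Ω → Set E} {Λ : ℕ → Ω → E → ℝ}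
  {μ : E → ℝ} {γ : ℤ → E → E → ℝ}

theorem AssumptionA1.integrable_prod_and_integral (hA1 : AssumptionA1 P S X Λ μ γ)
    {ι : Type*} [Fintype ι] (t : ι → ℕ) {s : ι → E} (hs : ∀ i, s i ∈ S) :
    Integrable (fun ω => ∏ i, Λ (t i) ω (s i)) P ∧
      ∫ ω, ∏ i, Λ (t i) ω (s i) ∂P = Real.exp (logMoment μ γ t s) := by
  have h := hA1.gaussian.integrable_exp_sum_and_integral
    (fun i => ((t i, ⟨s i, hs i⟩) : ℕ × S))
  simp only [Real.exp_sum, Real.exp_log (hA1.pos _ _ _ (hs _)), hA1.mean _ _ (hs _),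
    hA1.autocov _ _ _ (hs _) _ (hs _)] at h
  exact h

theorem AssumptionA1.autocov_symm (hA1 : AssumptionA1 P S X Λ μ γ) (t u : ℕ) {s s' : E}
    (hs : s ∈ S) (hs' : s' ∈ S) : γ ((t : ℤ) - u) s' s = γ ((u : ℤ) - t) s s' := by
  rw [← hA1.autocov t u s hs s' hs', ← hA1.autocov u t s' hs' s hs, covariance_comm]

/-- The covariance matrix of the joined family splits into four blocks. The two off-diagonal blocks
have the same sum by symmetry, which cancels the factor `1 / 2`. -/
theorem AssumptionA1.logMoment_sumElim (hA1 : AssumptionA1 P S X Λ μ γ)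
    {ι : Type*} [Fintype ι] (t u : ι → ℕ) {s s' : ι → E} (hs : ∀ i, s i ∈ S)
    (hs' : ∀ i, s' i ∈ S) :
    logMoment μ γ (Sum.elim t u) (Sum.elim s s') = logMoment μ γ t s + logMoment μ γ u s' +
      ∑ i, ∑ j, γ ((u j : ℤ) - (t i : ℤ)) (s i) (s' j) := by
  unfold logMoment
  simp only [Fintype.sum_sum_type, Sum.elim_inl, Sum.elim_inr, Finset.sum_add_distrib]
  have hcross : ∑ i, ∑ j, γ ((t j : ℤ) - (u i : ℤ)) (s' i) (s j) =
      ∑ i, ∑ j, γ ((u j : ℤ) - (t i : ℤ)) (s i) (s' j) := by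
    rw [Finset.sum_comm]
    exact Finset.sum_congr rfl fun i _ => Finset.sum_congr rfl fun j _ =>
      hA1.autocov_symm _ _ (hs i) (hs' j)
  rw [hcross]
  ring

end

/-! ### Random masses of the bins and their moments -/

/-- The intensity restricted to the region `R`, with values in `[0, ∞]`. -/
noncomputable def intensityOn {Ω E : Type*} (R : Set E) (Λ : ℕ → Ω → E → ℝ) (t : ℕ) (ω : Ω)
    (s : E) : ℝ≥0∞ :=
  R.indicator (fun s => ENNReal.ofReal (Λ t ω s)) s

theorem prod_intensityOn_eq_zero {Ω E ι : Type*} {R : Set E} {Λ : ℕ → Ω → E → ℝ} [Fintype ι] (t : ι → ℕ) {s : ι → E}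
    (hs : ¬ ∀ i, s i ∈ R) (ω : Ω) : ∏ i, intensityOn R Λ (t i) ω (s i) = 0 := by
  push Not at hs
  obtain ⟨i, hi⟩ := hs
  exact Finset.prod_eq_zero (Finset.mem_univ i) (Set.indicator_of_notMem hi _)

/-- The random mean `∫_B Λ_t` of the count in `B`, as an extended nonnegative number. -/
noncomputable def mass {Ω E : Type*} [MeasureSpace E] (R : Set E) (Λ : ℕ → Ω → E → ℝ) (B : Set E)
    (t : ℕ) (ω : Ω) : ℝ≥0∞ :=
  ∫⁻ s in B, intensityOn R Λ t ω s

section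

variable {Ω E : Type*} [MeasurableSpace Ω] [PseudoMetricSpace E] [MeasureSpace E]
  {P : Measure Ω} {S R : Set E} {X : ℕ → Ω → Set E} {Λ : ℕ → Ω → E → ℝ}
  {μ : E → ℝ} {γ : ℤ → E → E → ℝ}

/-- Joint measurability of `Λ t` is assumed only on `Ω × S`; cutting off outside `R ⊆ S` gives a
function measurable on all of `Ω × E`, as Tonelli requires. -/
theorem AssumptionA1.measurable_intensityOn (hA1 : AssumptionA1 P S X Λ μ γ) (hRS : R ⊆ S)
    (hR : MeasurableSet R) (t : ℕ) :
    Measurable (fun p : Ω × E => intensityOn R Λ t p.1 p.2) := by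
  have hA : MeasurableSet {p : Ω × E | p.2 ∈ R} := measurable_snd hR
  refine measurable_of_restrict_of_restrict_compl hA ?_ ?_
  · have hg : Measurable (fun p : {p : Ω × E | p.2 ∈ R} =>
        ((p.1.1, ⟨p.1.2, hRS p.2⟩) : Ω × S)) :=
      (measurable_fst.comp measurable_subtype_coe).prodMk
        ((measurable_snd.comp measurable_subtype_coe).subtype_mk)
    have he : Set.domRestrict {p : Ω × E | p.2 ∈ R} (fun p => intensityOn R Λ t p.1 p.2) =
        fun p => ENNReal.ofReal (Λ t p.1.1 p.1.2) := by
      ext p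
      exact Set.indicator_of_mem (s := R) p.2 fun s => ENNReal.ofReal (Λ t p.1.1 s)
    rw [he]
    exact ((hA1.measurable t).comp hg).ennreal_ofReal
  · have he : Set.domRestrict {p : Ω × E | p.2 ∈ R}ᶜ (fun p => intensityOn R Λ t p.1 p.2) =
        fun _ => 0 := by
      ext p
      exact Set.indicator_of_notMem (s := R) p.2 fun s => ENNReal.ofReal (Λ t p.1.1 s)
    rw [he]
    exact measurable_const

theorem AssumptionA1.lintegral_prod_intensityOn (hA1 : AssumptionA1 P S X Λ μ γ) (hRS : R ⊆ S)
    {ι : Type*} [Fintype ι] (t : ι → ℕ) {s : ι → E} (hs : ∀ i, s i ∈ R) :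
    ∫⁻ ω, ∏ i, intensityOn R Λ (t i) ω (s i) ∂P =
      ENNReal.ofReal (Real.exp (logMoment μ γ t s)) := by
  obtain ⟨h1, h2⟩ := hA1.integrable_prod_and_integral t fun i => hRS (hs i)
  rw [← h2, ofReal_integral_eq_lintegral_ofReal h1 (Eventually.of_forall fun ω =>
    Finset.prod_nonneg fun i _ => (hA1.pos _ _ _ (hRS (hs i))).le)]
  refine lintegral_congr fun ω => ?_
  rw [ENNReal.ofReal_prod_of_nonneg fun i _ => (hA1.pos _ _ _ (hRS (hs i))).le]
  exact Finset.prod_congr rfl fun i _ => Set.indicator_of_mem (hs i) _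

theorem AssumptionA1.lintegral_prod_intensityOn_add (hA1 : AssumptionA1 P S X Λ μ γ)
    (hRS : R ⊆ S) {ι : Type*} [Fintype ι] (u : ℕ) (t : ι → ℕ) (s : ι → E) :
    ∫⁻ ω, ∏ i, intensityOn R Λ (u + t i) ω (s i) ∂P =
      ∫⁻ ω, ∏ i, intensityOn R Λ (t i) ω (s i) ∂P := by
  by_cases hs : ∀ i, s i ∈ R
  · rw [hA1.lintegral_prod_intensityOn hRS (fun i => u + t i) hs,
      hA1.lintegral_prod_intensityOn hRS t hs, logMoment_add_left]
  · simp only [prod_intensityOn_eq_zero t hs, prod_intensityOn_eq_zero (fun i => u + t i) hs]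

/-- The joint moment exceeds the product of the two moments by the exponential of the cross block, a
sum of `(card ι) ^ 2` covariances, each at most `ε`. If some point lies outside `R`, the left side
is zero. -/
theorem AssumptionA1.lintegral_prod_mul_prod_intensityOn_le (hA1 : AssumptionA1 P S X Λ μ γ)
    (hRS : R ⊆ S) {ι : Type*} [Fintype ι] (t u : ι → ℕ) {ε : ℝ}
    (hε : ∀ i j, ∀ s ∈ R, ∀ s' ∈ R, γ ((u j : ℤ) - (t i : ℤ)) s s' ≤ ε) (s s' : ι → E) :
    ∫⁻ ω, (∏ i, intensityOn R Λ (t i) ω (s i)) * ∏ i, intensityOn R Λ (u i) ω (s' i) ∂P ≤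
      ENNReal.ofReal (Real.exp ((Fintype.card ι : ℝ) ^ 2 * ε)) *
        ((∫⁻ ω, ∏ i, intensityOn R Λ (t i) ω (s i) ∂P) *
          ∫⁻ ω, ∏ i, intensityOn R Λ (u i) ω (s' i) ∂P) := by
  by_cases hs : ∀ i, s i ∈ R
  swap; · simp [prod_intensityOn_eq_zero t hs]
  by_cases hs' : ∀ i, s' i ∈ R
  swap; · simp [prod_intensityOn_eq_zero u hs']
  have hss : ∀ i, Sum.elim s s' i ∈ R := by rintro (i | i) <;> simp [hs, hs']
  have h := hA1.lintegral_prod_intensityOn hRS (Sum.elim t u) hss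
  simp only [Fintype.prod_sum_type, Sum.elim_inl, Sum.elim_inr] at h
  rw [h, hA1.lintegral_prod_intensityOn hRS t hs, hA1.lintegral_prod_intensityOn hRS u hs',
    hA1.logMoment_sumElim t u (fun i => hRS (hs i)) (fun i => hRS (hs' i)),
    ← ENNReal.ofReal_mul (Real.exp_pos _).le, ← ENNReal.ofReal_mul (Real.exp_pos _).le,
    ← Real.exp_add, ← Real.exp_add]
  refine ENNReal.ofReal_le_ofReal (Real.exp_le_exp.2 ?_)
  have hb : ∑ i, ∑ j, γ ((u j : ℤ) - (t i : ℤ)) (s i) (s' j) ≤ ∑ _i : ι, ∑ _j : ι, ε :=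
    Finset.sum_le_sum fun i _ => Finset.sum_le_sum fun j _ => hε i j _ (hs i) _ (hs' j)
  simp only [Finset.sum_const, Finset.card_univ, nsmul_eq_mul] at hb
  linarith

theorem AssumptionA1.measurable_mass (hA1 : AssumptionA1 P S X Λ μ γ) (hRS : R ⊆ S)
    (hR : MeasurableSet R) [SFinite (volume : Measure E)] (B : Set E) (t : ℕ) :
    Measurable (mass R Λ B t) :=
  (hA1.measurable_intensityOn hRS hR t).lintegral_prod_right'

theorem AssumptionA1.measurable_prod_intensityOn (hA1 : AssumptionA1 P S X Λ μ γ) (hRS : R ⊆ S)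
    (hR : MeasurableSet R) {ι : Type*} [Fintype ι] (t : ι → ℕ) :
    Measurable (fun p : Ω × (ι → E) => ∏ i, intensityOn R Λ (t i) p.1 (p.2 i)) :=
  Finset.measurable_fun_prod _ fun i _ => (hA1.measurable_intensityOn hRS hR (t i)).comp
    (measurable_fst.prodMk ((measurable_pi_apply i).comp measurable_snd))

variable [SigmaFinite (volume : Measure E)] {ι : Type*} [Fintype ι]

theorem AssumptionA1.prod_mass (hA1 : AssumptionA1 P S X Λ μ γ) (hRS : R ⊆ S)
    (hR : MeasurableSet R) (B : ι → Set E) (t : ι → ℕ) (ω : Ω) :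
    ∏ i, mass R Λ (B i) (t i) ω =
      ∫⁻ s, ∏ i, intensityOn R Λ (t i) ω (s i) ∂Measure.pi fun i => volume.restrict (B i) :=
  (lintegral_fintype_prod_eq_prod fun i =>
    (hA1.measurable_intensityOn hRS hR (t i)).comp measurable_prodMk_left).symm

theorem AssumptionA1.lintegral_prod_mass (hA1 : AssumptionA1 P S X Λ μ γ) [SFinite P]
    (hRS : R ⊆ S) (hR : MeasurableSet R) (B : ι → Set E) (t : ι → ℕ) :
    ∫⁻ ω, ∏ i, mass R Λ (B i) (t i) ω ∂P =
      ∫⁻ s, ∫⁻ ω, ∏ i, intensityOn R Λ (t i) ω (s i) ∂P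
        ∂Measure.pi fun i => volume.restrict (B i) := by
  simp_rw [hA1.prod_mass hRS hR]
  exact lintegral_lintegral_swap (hA1.measurable_prod_intensityOn hRS hR t).aemeasurable

/-- The mixed moments of the masses are invariant under time shifts. -/
theorem AssumptionA1.lintegral_prod_mass_add (hA1 : AssumptionA1 P S X Λ μ γ) [SFinite P]
    (hRS : R ⊆ S) (hR : MeasurableSet R) (B : ι → Set E) (u : ℕ) (t : ι → ℕ) :
    ∫⁻ ω, ∏ i, mass R Λ (B i) (u + t i) ω ∂P = ∫⁻ ω, ∏ i, mass R Λ (B i) (t i) ω ∂P := by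
  rw [hA1.lintegral_prod_mass hRS hR B fun i => u + t i, hA1.lintegral_prod_mass hRS hR B t]
  simp_rw [hA1.lintegral_prod_intensityOn_add hRS u t]

/-- Two products of masses are almost uncorrelated if the cross covariances are small. -/
theorem AssumptionA1.lintegral_prod_mass_mul_prod_mass_le (hA1 : AssumptionA1 P S X Λ μ γ)
    [SFinite P] (hRS : R ⊆ S) (hR : MeasurableSet R) (B : ι → Set E) (t u : ι → ℕ) {ε : ℝ}
    (hε : ∀ i j, ∀ s ∈ R, ∀ s' ∈ R, γ ((u j : ℤ) - (t i : ℤ)) s s' ≤ ε) :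
    ∫⁻ ω, (∏ i, mass R Λ (B i) (t i) ω) * ∏ i, mass R Λ (B i) (u i) ω ∂P ≤
      ENNReal.ofReal (Real.exp ((Fintype.card ι : ℝ) ^ 2 * ε)) *
        ((∫⁻ ω, ∏ i, mass R Λ (B i) (t i) ω ∂P) * ∫⁻ ω, ∏ i, mass R Λ (B i) (u i) ω ∂P) := by
  set ν : Measure (ι → E) := Measure.pi fun i => volume.restrict (B i) with hν
  have hm := fun t => hA1.measurable_prod_intensityOn (Λ := Λ) hRS hR (ι := ι) t
  have hmω := fun t ω => (hm t).comp (measurable_prodMk_left (x := ω))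
  have hL : ∫⁻ ω, (∏ i, mass R Λ (B i) (t i) ω) * ∏ i, mass R Λ (B i) (u i) ω ∂P =
      ∫⁻ q, ∫⁻ ω, (∏ i, intensityOn R Λ (t i) ω (q.1 i)) * ∏ i, intensityOn R Λ (u i) ω (q.2 i) ∂P
        ∂(ν.prod ν) := by
    rw [← lintegral_lintegral_swap]
    · refine lintegral_congr fun ω => ?_
      rw [hA1.prod_mass hRS hR, hA1.prod_mass hRS hR, ← lintegral_prod_mul]
      · exact (hmω t ω).aemeasurable
      · exact (hmω u ω).aemeasurable
    · refine (Measurable.mul ?_ ?_).aemeasurable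
      · exact (hm t).comp (measurable_fst.prodMk (measurable_fst.comp measurable_snd))
      · exact (hm u).comp (measurable_fst.prodMk (measurable_snd.comp measurable_snd))
  rw [hL, hA1.lintegral_prod_mass hRS hR, hA1.lintegral_prod_mass hRS hR, ← hν,
    ← lintegral_prod_mul (hm t).lintegral_prod_left'.aemeasurable
      (hm u).lintegral_prod_left'.aemeasurable, ← lintegral_const_mul']
  · exact lintegral_mono fun q =>
      hA1.lintegral_prod_mul_prod_intensityOn_le hRS t u hε q.1 q.2
  · exact ENNReal.ofReal_ne_top

end

/-! ### Conditional Poisson law of the counts -/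

section

variable {Ω E : Type*} [MeasurableSpace Ω] [PseudoMetricSpace E] [MeasureSpace E]
  {P : Measure Ω} {S R : Set E} {X : ℕ → Ω → Set E} {Λ : ℕ → Ω → E → ℝ}
  {μ : E → ℝ} {γ : ℤ → E → E → ℝ}

theorem AssumptionA1.sigmaIntensity_le (hA1 : AssumptionA1 P S X Λ μ γ) :
    sigmaIntensity S Λ ≤ ‹MeasurableSpace Ω› := by
  refine iSup_le fun t => iSup_le fun s => ?_
  rw [← BorelSpace.measurable_eq (α := ℝ)]
  exact ((hA1.measurable t).comp (measurable_prodMk_right (y := s))).comap_le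

/-- The rate `∫_B Λ_t` of the conditional Poisson law of the count in `B`. -/
noncomputable def rate (Λ : ℕ → Ω → E → ℝ) (B : Set E) (t : ℕ) (ω : Ω) : ℝ≥0 :=
  (∫ s in B, Λ t ω s).toNNReal

theorem AssumptionA1.coe_rate (hA1 : AssumptionA1 P S X Λ μ γ) (hRS : R ⊆ S)
    (hRb : Bornology.IsBounded R) {B : Set E} (hB : MeasurableSet B) (hBR : B ⊆ R) (t : ℕ)
    (ω : Ω) : (rate Λ B t ω : ℝ≥0∞) = mass R Λ B t ω := by
  have h1 := hA1.locally_integrable t ω B (hBR.trans hRS) (hRb.subset hBR) hB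
  have h2 : 0 ≤ᵐ[volume.restrict B] Λ t ω := (ae_restrict_iff' hB).2
    (Eventually.of_forall fun s hs => (hA1.pos t ω s (hRS (hBR hs))).le)
  change ENNReal.ofReal (∫ s in B, Λ t ω s) = _
  rw [ofReal_integral_eq_lintegral_ofReal h1 h2]
  exact setLIntegral_congr_fun hB fun s hs =>
    (Set.indicator_of_mem (hBR hs) fun s => ENNReal.ofReal (Λ t ω s)).symm

theorem AssumptionA1.measurable_rate (hA1 : AssumptionA1 P S X Λ μ γ) (hRS : R ⊆ S)
    (hR : MeasurableSet R) (hRb : Bornology.IsBounded R) [SFinite (volume : Measure E)]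
    {B : Set E} (hB : MeasurableSet B) (hBR : B ⊆ R) (t : ℕ) : Measurable (rate Λ B t) := by
  have he : rate Λ B t = fun ω => (mass R Λ B t ω).toNNReal := by
    ext ω
    rw [← hA1.coe_rate hRS hRb hB hBR, ENNReal.toNNReal_coe]
  rw [he]
  exact (hA1.measurable_mass hRS hR B t).ennreal_toNNReal

/-- The index set is fibred over its times: conditional independence of the series separates the
times, complete independence of each Poisson process separates the disjoint bins at one time, and
the Poisson law gives each factor. -/
theorem AssumptionA1.condExp_iInter_count (hA1 : AssumptionA1 P S X Λ μ γ) {d : ℕ}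
    {B : Fin d → Set E} (hBS : ∀ j, B j ⊆ S) (hBb : ∀ j, Bornology.IsBounded (B j))
    (hB : ∀ j, MeasurableSet (B j)) (hdisj : Pairwise (Function.onFun Disjoint B))
    (J : Finset (ℕ × Fin d)) (n : ℕ × Fin d → ℕ) :
    P⟦⋂ p ∈ J, {ω | count (X p.1) (B p.2) ω = n p} | sigmaIntensity S Λ⟧ =ᵐ[P]
      fun ω => ∏ p ∈ J, (poissonMeasure (rate Λ (B p.2) p.1 ω)).real {n p} := by
  classical
  let T : Finset ℕ := J.image Prod.fst
  let D : ℕ → Finset (Fin d) := fun t => Finset.univ.filter fun j => (t, j) ∈ J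
  have hJ (p : ℕ × Fin d) : p ∈ J ↔ p.1 ∈ T ∧ p.2 ∈ D p.1 := by
    simp only [T, D, Finset.mem_image, Finset.mem_filter, Finset.mem_univ, true_and]
    exact ⟨fun h => ⟨⟨p, h, rfl⟩, h⟩, fun h => h.2⟩
  have hset : ⋂ p ∈ J, {ω | count (X p.1) (B p.2) ω = n p} =
      ⋂ t ∈ T, ⋂ j ∈ D t, {ω | count (X t) (B j) ω = n (t, j)} := by
    ext ω
    simp only [Set.mem_iInter, hJ, Prod.forall, and_imp]
    exact ⟨fun h t ht j hj => h t j ht hj, fun h t j ht hj => h t ht j hj⟩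
  have hmeas (t : ℕ) (j : Fin d) (k : ℕ) : MeasurableSet[MeasurableSpace.comap
      (count (X t) (B j)) ⊤] {ω | count (X t) (B j) ω = k} := ⟨{k}, trivial, rfl⟩
  have hout := hA1.condIndep T (fun t => ⋂ j ∈ D t, {ω | count (X t) (B j) ω = n (t, j)})
    fun t _ => by
      refine MeasurableSet.biInter (D t).countable_toSet fun j _ => ?_
      refine (?_ : MeasurableSpace.comap (count (X t) (B j)) ⊤ ≤ sigmaPoints S (X t)) _ (hmeas t j _)
      exact le_iSup₂_of_le (B j) ⟨hBS j, hBb j, hB j⟩ le_rfl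
  have hin (t : ℕ) := (hA1.poisson t).indep_count d B hBS hBb hB hdisj (D t)
    (fun j => {ω | count (X t) (B j) ω = n (t, j)}) fun j _ => hmeas t j _
  have hpo (t : ℕ) (j : Fin d) := (hA1.poisson t).poisson_count (B j) (hBS j) (hBb j) (hB j)
    (n (t, j))
  -- There are countably many times and bins, so one null set serves for all of them.
  have hin' : ∀ᵐ ω ∂P, ∀ t, _ := ae_all_iff.2 hin
  have hpo' : ∀ᵐ ω ∂P, ∀ t j, _ := ae_all_iff.2 fun t => ae_all_iff.2 (hpo t)
  rw [hset]
  filter_upwards [hout, hin', hpo'] with ω h1 h2 h3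
  rw [h1, Finset.prod_apply, Finset.prod_finset_product J T D hJ]
  refine Finset.prod_congr rfl fun t _ => ?_
  rw [h2, Finset.prod_apply]
  exact Finset.prod_congr rfl fun j _ => h3 t j

theorem AssumptionA1.measurable_count (hA1 : AssumptionA1 P S X Λ μ γ) (t : ℕ) {B : Set E}
    (hBS : B ⊆ S) (hBb : Bornology.IsBounded B) (hB : MeasurableSet B) :
    Measurable (count (X t) B) :=
  (hA1.pointProcess t).measurable_count B hBS hBb hB

theorem AssumptionA1.measure_iInter_count (hA1 : AssumptionA1 P S X Λ μ γ)
    [IsProbabilityMeasure P] {d : ℕ}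
    {B : Fin d → Set E} (hBS : ∀ j, B j ⊆ S) (hBb : ∀ j, Bornology.IsBounded (B j))
    (hB : ∀ j, MeasurableSet (B j)) (hdisj : Pairwise (Function.onFun Disjoint B))
    (J : Finset (ℕ × Fin d)) (n : ℕ × Fin d → ℕ) :
    P (⋂ p ∈ J, {ω | count (X p.1) (B p.2) ω = n p}) =
      ∫⁻ ω, ∏ p ∈ J, poissonMeasure (rate Λ (B p.2) p.1 ω) {n p} ∂P := by
  have hA : MeasurableSet (⋂ p ∈ J, {ω | count (X p.1) (B p.2) ω = n p}) :=
    MeasurableSet.biInter J.countable_toSet fun p _ =>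
      hA1.measurable_count p.1 (hBS p.2) (hBb p.2) (hB p.2) (measurableSet_singleton (n p))
  have hc := hA1.condExp_iInter_count hBS hBb hB hdisj J n
  have h := integral_condExp (μ := P) hA1.sigmaIntensity_le
    (f := (⋂ p ∈ J, {ω | count (X p.1) (B p.2) ω = n p}).indicator fun _ => (1 : ℝ))
  rw [integral_indicator_const _ hA, smul_eq_mul, mul_one, integral_congr_ae hc] at h
  rw [← ofReal_measureReal, ← h, ofReal_integral_eq_lintegral_ofReal
    (integrable_condExp.congr hc) (Eventually.of_forall fun ω =>
      Finset.prod_nonneg fun p _ => measureReal_nonneg)]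
  refine lintegral_congr fun ω => ?_
  rw [ENNReal.ofReal_prod_of_nonneg fun p _ => measureReal_nonneg]
  exact Finset.prod_congr rfl fun p _ => ofReal_measureReal

variable [SFinite (volume : Measure E)]

/-- The count vector is discrete, so its law is determined by its point masses, and these are those
of a mixture of products of Poisson laws. -/
theorem AssumptionA1.lintegral_prod_count (hA1 : AssumptionA1 P S X Λ μ γ)
    [IsProbabilityMeasure P] (hRS : R ⊆ S) (hR : MeasurableSet R) (hRb : Bornology.IsBounded R)
    {d : ℕ} {B : Fin d → Set E} (hBR : ∀ j, B j ⊆ R)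
    (hB : ∀ j, MeasurableSet (B j)) (hdisj : Pairwise (Function.onFun Disjoint B))
    (J : Finset (ℕ × Fin d)) (f : ℕ × Fin d → ℕ → ℝ≥0∞) :
    ∫⁻ ω, ∏ p ∈ J, f p (count (X p.1) (B p.2) ω) ∂P =
      ∫⁻ ω, ∏ p ∈ J, ∫⁻ n, f p n ∂poissonMeasure (rate Λ (B p.2) p.1 ω) ∂P := by
  have hBS := fun j => (hBR j).trans hRS
  have hBb := fun j => hRb.subset (hBR j)
  let N : Ω → J → ℕ := fun ω p => count (X p.1.1) (B p.1.2) ω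
  have hN : Measurable N := measurable_pi_lambda _ fun p =>
    hA1.measurable_count p.1.1 (hBS p.1.2) (hBb p.1.2) (hB p.1.2)
  have hlaw (n : J → ℕ) : P.map N {n} =
      ∫⁻ ω, ∏ p : J, poissonMeasure (rate Λ (B p.1.2) p.1.1 ω) {n p} ∂P := by
    classical
    have h := hA1.measure_iInter_count hBS hBb hB hdisj J
      -- The value `0` outside `J` is arbitrary: the intersection only involves indices in `J`.
      fun p => if hp : p ∈ J then n ⟨p, hp⟩ else 0
    rw [Measure.map_apply hN (measurableSet_singleton n)]
    convert! h using 2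
    · ext ω
      simp only [Set.mem_preimage, Set.mem_singleton_iff, Set.mem_iInter, funext_iff, N,
        Subtype.forall]
      refine forall₂_congr fun p hp => ?_
      simp [hp]
    · ext ω
      rw [← Finset.prod_coe_sort J]
      exact Finset.prod_congr rfl fun p _ => by simp
  have hmeas (p : J) (k : ℕ) :
      Measurable fun ω => poissonMeasure (rate Λ (B p.1.2) p.1.1 ω) {k} := by
    have := hA1.measurable_rate hRS hR hRb (hB p.1.2) (hBR p.1.2) p.1.1
    simp_rw [poissonMeasure_singleton]
    fun_prop
  calc ∫⁻ ω, ∏ p ∈ J, f p (count (X p.1) (B p.2) ω) ∂P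
      = ∫⁻ n, ∏ p : J, f p (n p) ∂P.map N := by
        rw [lintegral_map (Measurable.of_discrete) hN]
        exact lintegral_congr fun ω => (Finset.prod_coe_sort J _).symm
    _ = ∑' n : J → ℕ, ∫⁻ ω, (∏ p : J, f p (n p)) *
          ∏ p : J, poissonMeasure (rate Λ (B p.1.2) p.1.1 ω) {n p} ∂P := by
        rw [lintegral_countable']
        refine tsum_congr fun n => ?_
        rw [hlaw, lintegral_const_mul _ (Finset.measurable_fun_prod _ fun p _ => hmeas p _)]
    _ = ∫⁻ ω, ∑' n : J → ℕ, (∏ p : J, f p (n p)) *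
          ∏ p : J, poissonMeasure (rate Λ (B p.1.2) p.1.1 ω) {n p} ∂P :=
        (lintegral_tsum fun n => ((Finset.measurable_fun_prod _ fun p _ =>
          hmeas p _).const_mul _).aemeasurable).symm
    _ = _ := by
        refine lintegral_congr fun ω => ?_
        rw [← Finset.prod_coe_sort J, ← lintegral_fintype_prod_eq_prod
          (μ := fun p : J => poissonMeasure (rate Λ (B p.1.2) p.1.1 ω))
          (f := fun p : J => f p) fun p => Measurable.of_discrete, lintegral_countable']
        refine tsum_congr fun n => ?_
        rw [Measure.pi_singleton]

/-- The mixed factorial moments of the counts are the mixed moments of the masses. -/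
theorem AssumptionA1.lintegral_prod_descFactorial (hA1 : AssumptionA1 P S X Λ μ γ)
    [IsProbabilityMeasure P] (hRS : R ⊆ S) (hR : MeasurableSet R) (hRb : Bornology.IsBounded R)
    {d : ℕ} {B : Fin d → Set E} (hBR : ∀ j, B j ⊆ R)
    (hB : ∀ j, MeasurableSet (B j)) (hdisj : Pairwise (Function.onFun Disjoint B))
    (e : ℕ × Fin d →₀ ℕ) :
    ∫⁻ ω, e.prod (fun p m => ((count (X p.1) (B p.2) ω).descFactorial m : ℝ≥0∞)) ∂P =
      ∫⁻ ω, e.prod (fun p m => mass R Λ (B p.2) p.1 ω ^ m) ∂P := by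
  refine (hA1.lintegral_prod_count hRS hR hRb hBR hB hdisj e.support
    fun p n => (n.descFactorial (e p) : ℝ≥0∞)).trans ?_
  simp_rw [lintegral_descFactorial_poissonMeasure, hA1.coe_rate hRS hRb (hB _) (hBR _)]
  rfl

end

end CoxSeries

/-! ### Moment bounds and the law of large numbers for factorial monomials -/

/-- Ordinary moments are thereby controlled by factorial moments. For `n ≥ 2 * q` every factor of
the falling factorial is at least `n + 1 - q ≥ n / 2`; smaller `n` are absorbed by the constant. -/
theorem Nat.pow_le_two_pow_mul_descFactorial_add (n q : ℕ) :
    n ^ q ≤ 2 ^ q * n.descFactorial q + (2 * q) ^ q := by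
  rcases le_total n (2 * q) with h | h
  · exact (Nat.pow_le_pow_left h q).trans (Nat.le_add_left _ _)
  · calc n ^ q ≤ (2 * (n + 1 - q)) ^ q := Nat.pow_le_pow_left (by omega) q
      _ = 2 ^ q * (n + 1 - q) ^ q := mul_pow _ _ _
      _ ≤ 2 ^ q * n.descFactorial q := by gcongr; exact Nat.pow_sub_le_descFactorial n q
      _ ≤ _ := Nat.le_add_right _ _

theorem Finset.prod_sq_le_sum_pow {ι : Type*} [Fintype ι] [Nonempty ι] (y : ι → ℕ) :
    (∏ i, y i) ^ 2 ≤ ∑ i, y i ^ (2 * Fintype.card ι) := by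
  obtain ⟨i, hi⟩ := Finite.exists_max y
  calc (∏ j, y j) ^ 2 ≤ (y i ^ Fintype.card ι) ^ 2 := by
        gcongr
        exact Finset.prod_le_pow_card _ _ _ fun j _ => hi j
    _ = y i ^ (2 * Fintype.card ι) := by rw [← pow_mul, mul_comm]
    _ ≤ _ := Finset.single_le_sum (f := fun i => y i ^ (2 * Fintype.card ι))
        (fun _ _ => Nat.zero_le _) (Finset.mem_univ i)

namespace MeasureTheory

theorem integral_natCast {Ω : Type*} [MeasurableSpace Ω] {P : Measure Ω} {N : Ω → ℕ}
    (hN : Measurable N) : ∫ ω, (N ω : ℝ) ∂P = (∫⁻ ω, (N ω : ℝ≥0∞) ∂P).toReal := by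
  rw [integral_eq_lintegral_of_nonneg_ae (Eventually.of_forall fun ω => Nat.cast_nonneg _)
    (Measurable.aestronglyMeasurable (by fun_prop))]
  simp

theorem integrable_and_integral_of_ae_eq_toReal {α : Type*} [MeasurableSpace α] {ν : Measure α}
    {f : α → ℝ} {g : α → ℝ≥0∞} (hg : AEMeasurable g ν) (hfin : ∫⁻ x, g x ∂ν ≠ ∞)
    (hfg : f =ᵐ[ν] fun x => (g x).toReal) :
    Integrable f ν ∧ ∫ x, f x ∂ν = (∫⁻ x, g x ∂ν).toReal := by
  refine ⟨(integrable_toReal_of_lintegral_ne_top hg hfin).congr hfg.symm, ?_⟩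
  rw [integral_congr_ae hfg, integral_toReal hg (ae_lt_top' hg hfin)]

end MeasureTheory

namespace CoxSeries

theorem exists_bound_of_supNorm_lt_top {α : Type*} {f : α → ℝ} {A : Set α}
    (h : supNorm f A < ∞) : ∃ C : ℝ, ∀ x ∈ A, f x ≤ C := by
  refine ⟨(supNorm f A).toReal, fun x hx => ?_⟩
  have h1 : ‖f x‖ₑ ≤ supNorm f A := le_iSup₂_of_le x hx le_rfl
  have h2 := ENNReal.toReal_mono h.ne h1
  rw [toReal_enorm] at h2
  exact (le_abs_self _).trans h2

theorem AssumptionA2.exists_autocov_le {E : Type*} {R : Set E} {μ : E → ℝ} {γ : ℤ → E → E → ℝ}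
    (hA2 : AssumptionA2 R μ γ) {δ : ℝ} (hδ : 0 < δ) :
    ∃ K : ℕ, ∀ k : ℤ, K ≤ k → ∀ s ∈ R, ∀ s' ∈ R, γ k s s' ≤ δ := by
  obtain ⟨K, hK⟩ := eventually_atTop.1
    (hA2.autocov_tendsto.eventually (gt_mem_nhds (ENNReal.ofReal_pos.2 hδ)))
  refine ⟨K.toNat, fun k hk s hs s' hs' => ?_⟩
  have h1 : ‖γ k s s'‖ₑ ≤ supNorm (fun p : E × E => γ k p.1 p.2) (R ×ˢ R) :=
    le_iSup₂_of_le (f := fun (p : E × E) (_ : p ∈ R ×ˢ R) => ‖γ k p.1 p.2‖ₑ) (s, s') ⟨hs, hs'⟩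
      le_rfl
  have h2 := ENNReal.toReal_mono ENNReal.ofReal_ne_top
    (h1.trans (hK k (by have := Int.self_le_toNat K; omega)).le)
  rw [toReal_enorm, ENNReal.toReal_ofReal hδ.le] at h2
  exact (le_abs_self _).trans h2

/-- The exponents of the monomial `∏ᵢ y (t + lag i, bin i)` where `a i = (lag i, bin i)`. -/
noncomputable def exponents {ι : Type*} [Fintype ι] {d : ℕ} (a : ι → ℕ × Fin d) (t : ℕ) :
    ℕ × Fin d →₀ ℕ :=
  ∑ i, Finsupp.single (t + (a i).1, (a i).2) 1

theorem prod_pow_exponents {ι M : Type*} [Fintype ι] [CommMonoid M] {d : ℕ} (a : ι → ℕ × Fin d)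
    (t : ℕ) (y : ℕ × Fin d → M) :
    (exponents a t).prod (fun p m => y p ^ m) = ∏ i, y (t + (a i).1, (a i).2) := by
  rw [exponents, ← Finsupp.prod_finsetSum_index (by simp) (by simp [pow_add])]
  simp

/-- When all times of the first monomial precede `u`, the two monomials share no count, so their
product is again a factorial monomial. This fails for overlapping times, where only a second moment
bound is used. -/
theorem disjoint_support_exponents {ι : Type*} [Fintype ι] {d : ℕ} {a : ι → ℕ × Fin d}
    {t u : ℕ} (h : ∀ i, t + (a i).1 < u) :
    Disjoint (exponents a t).support (exponents a u).support := by
  classical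
  have hmem {t : ℕ} {p : ℕ × Fin d} (hp : p ∈ (exponents a t).support) :
      ∃ i, p = (t + (a i).1, (a i).2) := by
    obtain ⟨i, -, hi⟩ := Finset.mem_biUnion.1 (Finsupp.support_finsetSum hp)
    exact ⟨i, Finset.mem_singleton.1 (Finsupp.support_single_subset hi)⟩
  refine Finset.disjoint_left.2 fun p hp hp' => ?_
  obtain ⟨i, rfl⟩ := hmem hp
  obtain ⟨j, hj⟩ := hmem hp'
  have := congrArg Prod.fst hj
  have := h i
  simp only at *
  omega

/-- The factorial monomial in the bin counts with the exponents `exponents a t`. -/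
noncomputable def factorialMonomial {Ω E ι : Type*} [Fintype ι] {d : ℕ} (X : ℕ → Ω → Set E)
    (B : Fin d → Set E) (a : ι → ℕ × Fin d) (t : ℕ) (ω : Ω) : ℕ :=
  (exponents a t).prod fun p m => (count (X p.1) (B p.2) ω).descFactorial m

theorem factorialMonomial_le {Ω E ι : Type*} [Fintype ι] {d : ℕ} (X : ℕ → Ω → Set E)
    (B : Fin d → Set E) (a : ι → ℕ × Fin d) (t : ℕ) (ω : Ω) :
    factorialMonomial X B a t ω ≤ ∏ i, count (X (t + (a i).1)) (B (a i).2) ω := by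
  rw [← prod_pow_exponents a t fun p => count (X p.1) (B p.2) ω]
  exact Finset.prod_le_prod' fun p _ => Nat.descFactorial_le_pow _ _

section

variable {Ω E : Type*} [MeasurableSpace Ω] [PseudoMetricSpace E] [MeasureSpace E]
  {P : Measure Ω} {S R : Set E} {X : ℕ → Ω → Set E} {Λ : ℕ → Ω → E → ℝ}
  {μ : E → ℝ} {γ : ℤ → E → E → ℝ}

variable {d : ℕ} {B : Fin d → Set E} {ι : Type*} [Fintype ι]

theorem AssumptionA1.measurable_factorialMonomial (hA1 : AssumptionA1 P S X Λ μ γ) (hRS : R ⊆ S)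
    (hRb : Bornology.IsBounded R) (hBR : ∀ j, B j ⊆ R) (hB : ∀ j, MeasurableSet (B j))
    (a : ι → ℕ × Fin d) (t : ℕ) : Measurable (factorialMonomial X B a t) :=
  Finset.measurable_fun_prod _ fun p _ => (Measurable.of_discrete
    (f := fun n : ℕ => n.descFactorial (exponents a t p))).comp
    (hA1.measurable_count p.1 ((hBR p.2).trans hRS) (hRb.subset (hBR p.2)) (hB p.2))

variable [SigmaFinite (volume : Measure E)] [IsProbabilityMeasure P]

/-- The powers of the masses have finite expectations. -/
theorem AssumptionA1.lintegral_mass_pow_lt_top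
    [IsFiniteMeasureOnCompacts (volume : Measure E)] [ProperSpace E]
    (hA1 : AssumptionA1 P S X Λ μ γ)
    (hA2 : AssumptionA2 R μ γ) (hRS : R ⊆ S) (hR : MeasurableSet R)
    {B : Set E} (hB : Bornology.IsBounded B) (q : ℕ) :
    ∫⁻ ω, mass R Λ B 0 ω ^ q ∂P < ∞ := by
  obtain ⟨A, hA⟩ := exists_bound_of_supNorm_lt_top hA2.mean_bounded
  obtain ⟨G, hG⟩ := exists_bound_of_supNorm_lt_top (hA2.autocov_bounded 0)
  -- The `q`-th power is the product of `q` copies of one mass, so its moment is an integral over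
  -- `q` points of `B`.
  have hprod := hA1.lintegral_prod_mass hRS hR (fun _ : Fin q => B) (fun _ => 0)
  simp only [Finset.prod_const, Finset.card_univ, Fintype.card_fin] at hprod
  rw [hprod]
  have hle (s : Fin q → E) : ∫⁻ ω, ∏ i, intensityOn R Λ 0 ω (s i) ∂P ≤
      ENNReal.ofReal (Real.exp (q * A + (q * (q * G)) / 2)) := by
    by_cases hs : ∀ i, s i ∈ R
    · rw [hA1.lintegral_prod_intensityOn hRS (fun _ => 0) hs]
      refine ENNReal.ofReal_le_ofReal (Real.exp_le_exp.2 ?_)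
      have h1 : ∑ i, μ (s i) ≤ ∑ _i : Fin q, A := Finset.sum_le_sum fun i _ => hA _ (hs i)
      have h2 : ∑ i, ∑ j, γ 0 (s i) (s j) ≤ ∑ _i : Fin q, ∑ _j : Fin q, G :=
        Finset.sum_le_sum fun i _ => Finset.sum_le_sum fun j _ =>
          hG (s i, s j) ⟨hs i, hs j⟩
      simp only [Finset.sum_const, Finset.card_univ, Fintype.card_fin, nsmul_eq_mul] at h1 h2
      simp only [logMoment, sub_self]
      linarith
    · simp only [prod_intensityOn_eq_zero (fun _ => 0) hs, lintegral_zero, zero_le]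
  refine (lintegral_mono hle).trans_lt ?_
  rw [lintegral_const]
  refine ENNReal.mul_lt_top ENNReal.ofReal_lt_top ?_
  rw [Measure.pi_univ]
  exact ENNReal.prod_lt_top fun i _ => by simpa using hB.measure_lt_top

theorem AssumptionA1.lintegral_mass_pow (hA1 : AssumptionA1 P S X Λ μ γ) (hRS : R ⊆ S)
    (hR : MeasurableSet R) (B : Set E) (t q : ℕ) :
    ∫⁻ ω, mass R Λ B t ω ^ q ∂P = ∫⁻ ω, mass R Λ B 0 ω ^ q ∂P := by
  simpa using hA1.lintegral_prod_mass_add hRS hR (fun _ : Fin q => B) t fun _ => 0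

theorem AssumptionA1.exists_lintegral_count_pow_le
    [IsFiniteMeasureOnCompacts (volume : Measure E)] [ProperSpace E]
    (hA1 : AssumptionA1 P S X Λ μ γ)
    (hA2 : AssumptionA2 R μ γ) (hRS : R ⊆ S) (hR : MeasurableSet R)
    (hRb : Bornology.IsBounded R) (hBR : ∀ j, B j ⊆ R)
    (hB : ∀ j, MeasurableSet (B j)) (hdisj : Pairwise (Function.onFun Disjoint B)) (j : Fin d)
    (q : ℕ) : ∃ M : ℝ≥0, ∀ t, ∫⁻ ω, ((count (X t) (B j) ω ^ q : ℕ) : ℝ≥0∞) ∂P ≤ M := by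
  have hfin : 2 ^ q * ∫⁻ ω, mass R Λ (B j) 0 ω ^ q ∂P + (2 * q) ^ q ≠ ∞ := by
    have := hA1.lintegral_mass_pow_lt_top hA2 hRS hR (hRb.subset (hBR j)) q
    finiteness
  refine ⟨ENNReal.toNNReal _, fun t => le_of_le_of_eq ?_ (ENNReal.coe_toNNReal hfin).symm⟩
  have hfac := hA1.lintegral_prod_descFactorial hRS hR hRb hBR hB hdisj
    (Finsupp.single (t, j) q)
  simp only [Nat.descFactorial_zero, Nat.cast_one, Finsupp.prod_single_index, pow_zero] at hfac
  rw [← hA1.lintegral_mass_pow hRS hR (B j) t, ← hfac, ← lintegral_const_mul' _ _ (by finiteness)]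
  calc _ ≤ ∫⁻ ω, (2 ^ q * ((count (X t) (B j) ω).descFactorial q : ℝ≥0∞) + (2 * q) ^ q) ∂P :=
        lintegral_mono fun ω => by
          have h := Nat.cast_le (α := ℝ≥0∞).2
            (Nat.pow_le_two_pow_mul_descFactorial_add (count (X t) (B j) ω) q)
          push_cast at h ⊢
          exact h
    _ = _ := by
        rw [lintegral_add_right _ measurable_const, lintegral_const, measure_univ, mul_one]

/-- The square of a factorial monomial is not a factorial monomial. It is bounded by the squared
product of the counts, hence by a sum of pure powers, whose moments are bounded uniformly in time.
-/
theorem AssumptionA1.exists_lintegral_factorialMonomial_sq_le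
    [IsFiniteMeasureOnCompacts (volume : Measure E)] [ProperSpace E]
    (hA1 : AssumptionA1 P S X Λ μ γ)
    (hA2 : AssumptionA2 R μ γ) (hRS : R ⊆ S) (hR : MeasurableSet R)
    (hRb : Bornology.IsBounded R) (hBR : ∀ j, B j ⊆ R)
    (hB : ∀ j, MeasurableSet (B j)) (hdisj : Pairwise (Function.onFun Disjoint B))
    [Nonempty ι] (a : ι → ℕ × Fin d) :
    ∃ M : ℝ≥0, ∀ t, ∫⁻ ω, ((factorialMonomial X B a t ω ^ 2 : ℕ) : ℝ≥0∞) ∂P ≤ M := by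
  choose M hM using fun j => hA1.exists_lintegral_count_pow_le hA2 hRS hR hRb hBR hB hdisj j
    (2 * Fintype.card ι)
  refine ⟨∑ i, M (a i).2, fun t => ?_⟩
  calc ∫⁻ ω, ((factorialMonomial X B a t ω ^ 2 : ℕ) : ℝ≥0∞) ∂P
      ≤ ∫⁻ ω, ∑ i, ((count (X (t + (a i).1)) (B (a i).2) ω ^ (2 * Fintype.card ι) : ℕ) : ℝ≥0∞)
          ∂P := lintegral_mono fun ω => by
        rw [← Nat.cast_sum]
        exact Nat.cast_le.2 ((Nat.pow_le_pow_left (factorialMonomial_le X B a t ω) 2).trans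
          (Finset.prod_sq_le_sum_pow _))
    _ = ∑ i, ∫⁻ ω, ((count (X (t + (a i).1)) (B (a i).2) ω ^ (2 * Fintype.card ι) : ℕ) : ℝ≥0∞)
          ∂P := lintegral_finsetSum _ fun i _ => (Measurable.of_discrete
            (f := fun n : ℕ => ((n ^ (2 * Fintype.card ι) : ℕ) : ℝ≥0∞))).comp
            (hA1.measurable_count _ ((hBR _).trans hRS) (hRb.subset (hBR _)) (hB _))
    _ ≤ ∑ i, (M (a i).2 : ℝ≥0∞) := Finset.sum_le_sum fun i _ => hM _ _
    _ = _ := by push_cast; rfl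

theorem AssumptionA1.lintegral_factorialMonomial (hA1 : AssumptionA1 P S X Λ μ γ)
    (hRS : R ⊆ S) (hR : MeasurableSet R)
    (hRb : Bornology.IsBounded R) (hBR : ∀ j, B j ⊆ R)
    (hB : ∀ j, MeasurableSet (B j)) (hdisj : Pairwise (Function.onFun Disjoint B))
    (a : ι → ℕ × Fin d) (t : ℕ) :
    ∫⁻ ω, (factorialMonomial X B a t ω : ℝ≥0∞) ∂P =
      ∫⁻ ω, ∏ i, mass R Λ (B (a i).2) (a i).1 ω ∂P := by
  have h := hA1.lintegral_prod_descFactorial hRS hR hRb hBR hB hdisj (exponents a t)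
  simp_rw [prod_pow_exponents a t fun p => mass R Λ (B p.2) p.1 _] at h
  rw [← hA1.lintegral_prod_mass_add hRS hR (fun i => B (a i).2) t, ← h]
  simp [factorialMonomial, Finsupp.prod]

theorem AssumptionA1.lintegral_factorialMonomial_mul_le (hA1 : AssumptionA1 P S X Λ μ γ)
    (hRS : R ⊆ S) (hR : MeasurableSet R)
    (hRb : Bornology.IsBounded R) (hBR : ∀ j, B j ⊆ R)
    (hB : ∀ j, MeasurableSet (B j)) (hdisj : Pairwise (Function.onFun Disjoint B))
    (a : ι → ℕ × Fin d) {t u : ℕ} (htu : ∀ i, t + (a i).1 < u) {δ : ℝ}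
    (hδ : ∀ i j, ∀ s ∈ R, ∀ s' ∈ R,
      γ (((u + (a j).1 : ℕ) : ℤ) - ((t + (a i).1 : ℕ) : ℤ)) s s' ≤ δ) :
    ∫⁻ ω, ((factorialMonomial X B a t ω * factorialMonomial X B a u ω : ℕ) : ℝ≥0∞) ∂P ≤
      ENNReal.ofReal (Real.exp ((Fintype.card ι : ℝ) ^ 2 * δ)) *
        (∫⁻ ω, ∏ i, mass R Λ (B (a i).2) (a i).1 ω ∂P) ^ 2 := by
  have h := hA1.lintegral_prod_descFactorial hRS hR hRb hBR hB hdisj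
    (exponents a t + exponents a u)
  simp_rw [Finsupp.prod_add_index_of_disjoint (disjoint_support_exponents htu),
    prod_pow_exponents a _ fun p => mass R Λ (B p.2) p.1 _] at h
  have hle := hA1.lintegral_prod_mass_mul_prod_mass_le hRS hR (fun i => B (a i).2)
    (fun i => t + (a i).1) (fun i => u + (a i).1) hδ
  rw [hA1.lintegral_prod_mass_add hRS hR (fun i => B (a i).2) t,
    hA1.lintegral_prod_mass_add hRS hR (fun i => B (a i).2) u, ← h, ← sq] at hle
  simpa [factorialMonomial, Finsupp.prod] using hle

/-- The average of a factorial monomial along the time series is a consistent estimator of the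
corresponding mixed moment of the masses. -/
theorem AssumptionA1.tendstoInMeasure_factorialMonomial
    [IsFiniteMeasureOnCompacts (volume : Measure E)] [ProperSpace E]
    (hA1 : AssumptionA1 P S X Λ μ γ)
    (hA2 : AssumptionA2 R μ γ) (hRS : R ⊆ S) (hR : MeasurableSet R)
    (hRb : Bornology.IsBounded R) (hBR : ∀ j, B j ⊆ R)
    (hB : ∀ j, MeasurableSet (B j)) (hdisj : Pairwise (Function.onFun Disjoint B))
    [Nonempty ι] (a : ι → ℕ × Fin d) :
    (∫⁻ ω, ∏ i, mass R Λ (B (a i).2) (a i).1 ω ∂P ≠ ∞) ∧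
    (∀ t, Integrable (fun ω => (factorialMonomial X B a t ω : ℝ)) P) ∧
    (∀ t, ∫ ω, (factorialMonomial X B a t ω : ℝ) ∂P =
      (∫⁻ ω, ∏ i, mass R Λ (B (a i).2) (a i).1 ω ∂P).toReal) ∧
    TendstoInMeasure P
      (fun (n : ℕ) ω => (1 / (n : ℝ)) * ∑ t ∈ Finset.range n, (factorialMonomial X B a t ω : ℝ))
      atTop (fun _ => (∫⁻ ω, ∏ i, mass R Λ (B (a i).2) (a i).1 ω ∂P).toReal) := by
  obtain ⟨M, hM⟩ := hA1.exists_lintegral_factorialMonomial_sq_le hA2 hRS hR hRb hBR hB hdisj a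
  have hZ := hA1.measurable_factorialMonomial hRS hRb hBR hB a
  have hmom := hA1.lintegral_factorialMonomial hRS hR hRb hBR hB hdisj a
  set m := ∫⁻ ω, ∏ i, mass R Λ (B (a i).2) (a i).1 ω ∂P with hm
  have hfin : m ≠ ∞ := by
    rw [← hmom 0]
    refine ne_top_of_le_ne_top ENNReal.coe_ne_top ((lintegral_mono fun ω => ?_).trans (hM 0))
    exact Nat.cast_le.2 (Nat.le_self_pow two_ne_zero _)
  have hmean (t : ℕ) : ∫ ω, (factorialMonomial X B a t ω : ℝ) ∂P = m.toReal := by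
    rw [integral_natCast (hZ t), hmom]
  have hcast (t : ℕ) : Measurable fun ω => (factorialMonomial X B a t ω : ℝ) :=
    (Measurable.of_discrete (f := fun n : ℕ => (n : ℝ))).comp (hZ t)
  have hsq (t : ℕ) : ∫ ω, (factorialMonomial X B a t ω : ℝ) ^ 2 ∂P ≤ M := by
    have := integral_natCast (P := P) ((hZ t).pow_const 2)
    push_cast at this
    rw [this]
    have h2 := hM t
    push_cast at h2
    exact ENNReal.toReal_mono ENNReal.coe_ne_top h2
  have hLp (t : ℕ) : MemLp (fun ω => (factorialMonomial X B a t ω : ℝ)) 2 P := by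
    rw [memLp_two_iff_integrable_sq (hcast t).aestronglyMeasurable]
    refine ⟨((hcast t).pow_const 2).aestronglyMeasurable, ?_⟩
    refine lt_of_le_of_lt ?_ (ENNReal.coe_lt_top (r := M))
    refine le_trans (le_of_eq (lintegral_congr fun ω => ?_)) (hM t)
    beta_reduce
    rw [← Nat.cast_pow, ← ofReal_norm, RCLike.norm_natCast, ENNReal.ofReal_natCast]
  refine ⟨hfin, fun t => (hLp t).integrable (by norm_num), hmean,
    tendstoInMeasure_average hLp hmean hsq fun ε hε => ?_⟩
  -- By continuity at `0`, a small positive covariance bound `δ` costs less than `ε` in the product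
  -- of the means.
  obtain ⟨δ, hδ, hδ0⟩ : ∃ δ : ℝ,
      Real.exp ((Fintype.card ι : ℝ) ^ 2 * δ) * m.toReal ^ 2 < m.toReal ^ 2 + ε ∧ 0 < δ := by
    have hc : Tendsto (fun δ : ℝ => Real.exp ((Fintype.card ι : ℝ) ^ 2 * δ) * m.toReal ^ 2)
        (𝓝 0) (𝓝 (m.toReal ^ 2)) := by
      have : Continuous fun δ : ℝ =>
        Real.exp ((Fintype.card ι : ℝ) ^ 2 * δ) * m.toReal ^ 2 := by fun_prop
      simpa using this.tendsto 0
    have h1 := (hc.eventually (gt_mem_nhds (lt_add_of_pos_right _ hε))).filter_mono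
      (nhdsWithin_le_nhds (s := Set.Ioi 0))
    exact (h1.and self_mem_nhdsWithin).exists
  obtain ⟨K, hK⟩ := hA2.exists_autocov_le hδ0
  obtain ⟨i₀, hi₀⟩ := Finite.exists_max fun i => (a i).1
  -- With `(a i₀).1` the largest lag, this gap puts every time of the first monomial strictly before
  -- `u` and keeps all time differences between the two monomials at least `K`.
  refine ⟨K + (a i₀).1 + 1, fun t u htu => ?_⟩
  have hle := hA1.lintegral_factorialMonomial_mul_le hRS hR hRb hBR hB hdisj a (t := t) (u := u)
    (δ := δ) (fun i => by have := hi₀ i; omega) fun i j =>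
      hK _ (by have := hi₀ i; push_cast; omega)
  have hint := integral_natCast (P := P) ((hZ t).mul (hZ u))
  simp only [Pi.mul_apply, Nat.cast_mul] at hint hle
  rw [hint]
  refine (ENNReal.toReal_mono (by finiteness) hle).trans ?_
  rw [ENNReal.toReal_mul, ENNReal.toReal_pow, ENNReal.toReal_ofReal (Real.exp_pos _).le]
  exact hδ.le

end

/-! ### The monomials of degree one and two, and their limits -/

theorem factorialMonomial_single {Ω E : Type*} {d : ℕ} (X : ℕ → Ω → Set E) (B : Fin d → Set E)
    (j : Fin d) (t : ℕ) (ω : Ω) :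
    factorialMonomial X B (fun _ : Unit => (0, j)) t ω = count (X t) (B j) ω := by
  simp only [factorialMonomial, exponents, add_zero, Finset.univ_unique, Finset.sum_singleton]
  rw [Finsupp.prod_single_index (by simp), Nat.descFactorial_one]

/-- The factorial monomial of degree two is the product of the counts, corrected by the count
itself if the two counts coincide. -/
theorem factorialMonomial_pair {Ω E : Type*} {d : ℕ} (X : ℕ → Ω → Set E) (B : Fin d → Set E)
    (k : ℕ) (j j' : Fin d) (t : ℕ) (ω : Ω) :
    (factorialMonomial X B ![(0, j), (k, j')] t ω : ℝ) =
      count (X t) (B j) ω * count (X (t + k)) (B j') ω -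
        if k = 0 ∧ j = j' then (count (X t) (B j) ω : ℝ) else 0 := by
  simp only [factorialMonomial, exponents, Fin.sum_univ_two, Matrix.cons_val_zero,
    Matrix.cons_val_one, add_zero]
  split_ifs with h
  · obtain ⟨rfl, rfl⟩ := h
    rw [add_zero, ← Finsupp.single_add, Finsupp.prod_single_index (by simp)]
    -- The falling factorial involves the truncated difference `count - 1`, so zero is treated
    -- apart.
    rcases count (X t) (B j) ω with _ | n
    · simp
    · simp [Nat.descFactorial_succ]
      ring
  · have hne : (t, j) ≠ (t + k, j') := by
      rintro heq
      simp only [Prod.mk.injEq] at heq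
      exact h ⟨by omega, heq.2⟩
    rw [Finsupp.prod_add_index_of_disjoint, Finsupp.prod_single_index (by simp),
      Finsupp.prod_single_index (by simp)]
    · simp
    · rw [Finsupp.support_single _ one_ne_zero, Finsupp.support_single _ one_ne_zero]
      simpa using hne

section

variable {Ω E : Type*} [MeasurableSpace Ω] [PseudoMetricSpace E] [MeasureSpace E]
  {P : Measure Ω} {S R : Set E} {X : ℕ → Ω → Set E} {Λ : ℕ → Ω → E → ℝ}
  {μ : E → ℝ} {γ : ℤ → E → E → ℝ}

theorem AssumptionA1.integrable_and_integral_eq_nu (hA1 : AssumptionA1 P S X Λ μ γ) (t : ℕ)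
    {s : E} (hs : s ∈ S) :
    Integrable (fun ω => Λ t ω s) P ∧ ∫ ω, Λ t ω s ∂P = nu P Λ s := by
  -- The time is written `u + 0` to display it as a shift of time `0`, so that `logMoment_add_left`
  -- removes `u`.
  have h (u : ℕ) := hA1.integrable_prod_and_integral (ι := Unit) (fun _ => u + 0)
    (s := fun _ => s) fun _ => hs
  simp only [logMoment_add_left] at h
  simp only [add_zero, Finset.univ_unique, Finset.prod_singleton] at h
  exact ⟨(h t).1, (h t).2.trans (h 0).2.symm⟩

theorem AssumptionA1.integrable_and_integral_eq_c (hA1 : AssumptionA1 P S X Λ μ γ) (t k : ℕ)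
    {s s' : E} (hs : s ∈ S) (hs' : s' ∈ S) :
    Integrable (fun ω => Λ t ω s * Λ (t + k) ω s') P ∧
      ∫ ω, Λ t ω s * Λ (t + k) ω s' ∂P = c P Λ k s s' := by
  have h (u : ℕ) := hA1.integrable_prod_and_integral (fun i => u + ![0, k] i)
    (s := ![s, s']) fun i => by fin_cases i <;> simpa
  simp only [logMoment_add_left] at h
  simp only [Fin.prod_univ_two, Matrix.cons_val_zero, Matrix.cons_val_one, add_zero] at h
  refine ⟨(h t).1, (h t).2.trans ?_⟩
  rw [← (h 0).2, c]
  simp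

theorem AssumptionA1.nu_eq_toReal (hA1 : AssumptionA1 P S X Λ μ γ) (hRS : R ⊆ S) {s : E}
    (hs : s ∈ R) : nu P Λ s = (∫⁻ ω, intensityOn R Λ 0 ω s ∂P).toReal := by
  rw [nu, integral_eq_lintegral_of_nonneg_ae
    (Eventually.of_forall fun ω => (hA1.pos _ _ _ (hRS hs)).le)
    (hA1.integrable_and_integral_eq_nu 0 (hRS hs)).1.aestronglyMeasurable]
  simp [intensityOn, hs]

theorem AssumptionA1.c_eq_toReal (hA1 : AssumptionA1 P S X Λ μ γ) (hRS : R ⊆ S) (k : ℕ)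
    {s s' : E} (hs : s ∈ R) (hs' : s' ∈ R) :
    c P Λ k s s' = (∫⁻ ω, intensityOn R Λ 0 ω s * intensityOn R Λ k ω s' ∂P).toReal := by
  have h := (hA1.integrable_and_integral_eq_c 0 k (hRS hs) (hRS hs')).1
  rw [zero_add] at h
  rw [c, integral_eq_lintegral_of_nonneg_ae (Eventually.of_forall fun ω =>
    mul_nonneg (hA1.pos _ _ _ (hRS hs)).le (hA1.pos _ _ _ (hRS hs')).le) h.aestronglyMeasurable]
  simp [intensityOn, hs, hs', ENNReal.ofReal_mul (hA1.pos _ _ _ (hRS hs)).le]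

variable [SigmaFinite (volume : Measure E)] [SFinite P]

theorem AssumptionA1.integrableOn_nu_and_integral (hA1 : AssumptionA1 P S X Λ μ γ) (hRS : R ⊆ S)
    (hR : MeasurableSet R) {B : Set E} (hB : MeasurableSet B) (hBR : B ⊆ R)
    (hfin : ∫⁻ ω, mass R Λ B 0 ω ∂P ≠ ∞) :
    IntegrableOn (nu P Λ) B ∧ ∫ s in B, nu P Λ s = (∫⁻ ω, mass R Λ B 0 ω ∂P).toReal := by
  have hm := hA1.measurable_intensityOn hRS hR 0
  have hswap : ∫⁻ ω, mass R Λ B 0 ω ∂P = ∫⁻ s in B, ∫⁻ ω, intensityOn R Λ 0 ω s ∂P :=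
    lintegral_lintegral_swap hm.aemeasurable
  rw [hswap] at hfin ⊢
  refine integrable_and_integral_of_ae_eq_toReal hm.lintegral_prod_left'.aemeasurable hfin ?_
  filter_upwards [ae_restrict_mem hB] with s hs using hA1.nu_eq_toReal hRS (hBR hs)

theorem AssumptionA1.integrableOn_c_and_integral (hA1 : AssumptionA1 P S X Λ μ γ) (hRS : R ⊆ S)
    (hR : MeasurableSet R) {B B' : Set E} (hB : MeasurableSet B) (hBR : B ⊆ R)
    (hB' : MeasurableSet B') (hBR' : B' ⊆ R) (k : ℕ)
    (hfin : ∫⁻ ω, mass R Λ B 0 ω * mass R Λ B' k ω ∂P ≠ ∞) :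
    IntegrableOn (fun p : E × E => c P Λ k p.1 p.2) (B ×ˢ B') (volume.prod volume) ∧
      ∫ p in B ×ˢ B', c P Λ k p.1 p.2 ∂(volume.prod volume) =
        (∫⁻ ω, mass R Λ B 0 ω * mass R Λ B' k ω ∂P).toReal := by
  have hm := hA1.measurable_intensityOn hRS hR
  have hm2 : Measurable fun q : Ω × (E × E) =>
      intensityOn R Λ 0 q.1 q.2.1 * intensityOn R Λ k q.1 q.2.2 :=
    ((hm 0).comp (measurable_fst.prodMk (measurable_fst.comp measurable_snd))).mul
      ((hm k).comp (measurable_fst.prodMk (measurable_snd.comp measurable_snd)))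
  have hswap : ∫⁻ ω, mass R Λ B 0 ω * mass R Λ B' k ω ∂P =
      ∫⁻ p in B ×ˢ B', ∫⁻ ω, intensityOn R Λ 0 ω p.1 * intensityOn R Λ k ω p.2 ∂P
        ∂(volume.prod volume) := by
    rw [← lintegral_lintegral_swap hm2.aemeasurable, ← Measure.prod_restrict]
    refine lintegral_congr fun ω => ?_
    rw [lintegral_prod_mul]
    · rfl
    · exact ((hm 0).comp measurable_prodMk_left).aemeasurable
    · exact ((hm k).comp measurable_prodMk_left).aemeasurable
  rw [hswap] at hfin ⊢
  refine integrable_and_integral_of_ae_eq_toReal hm2.lintegral_prod_left'.aemeasurable hfin ?_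
  filter_upwards [ae_restrict_mem (hB.prod hB')] with p hp using
    hA1.c_eq_toReal hRS k (hBR hp.1) (hBR' hp.2)

end

end CoxSeries

/-! ### Consistency of the estimators -/

theorem theorem1 {Ω : Type*} [MeasurableSpace Ω] (P : Measure Ω) [IsProbabilityMeasure P]
    {E : Type*} [NormedAddCommGroup E] [InnerProductSpace ℝ E] [FiniteDimensional ℝ E]
    [MeasurableSpace E] [BorelSpace E]
    (S : Set E) (hS : MeasurableSet S)
    (R : Set E) (hRS : R ⊆ S) (hRb : Bornology.IsBounded R)
    {d : ℕ} (Rb : Fin d → Set E) (hRbm : ∀ j, MeasurableSet (Rb j))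
    (hdisj : Pairwise (Function.onFun Disjoint Rb)) (hunion : ⋃ j, Rb j = R)
    (X : ℕ → Ω → Set E) (Λ : ℕ → Ω → E → ℝ) (μ : E → ℝ) (γ : ℤ → E → E → ℝ)
    (hA1 : CoxSeries.AssumptionA1 P S X Λ μ γ) (hA2 : CoxSeries.AssumptionA2 R μ γ) :
    -- `ν` and the `c_k` are well defined: finite expectations that do not depend on the time `t`,
    -- integrable over the bins
    (∀ t, ∀ s ∈ S, Integrable (fun ω => Λ t ω s) P ∧
      ∫ ω, Λ t ω s ∂P = CoxSeries.nu P Λ s) ∧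
    (∀ t k, ∀ s ∈ S, ∀ s' ∈ S, Integrable (fun ω => Λ t ω s * Λ (t + k) ω s') P ∧
      ∫ ω, Λ t ω s * Λ (t + k) ω s' ∂P = CoxSeries.c P Λ k s s') ∧
    (∀ j, IntegrableOn (CoxSeries.nu P Λ) (Rb j)) ∧
    (∀ k j j', IntegrableOn (fun p : E × E => CoxSeries.c P Λ k p.1 p.2) (Rb j ×ˢ Rb j')
      (volume.prod volume)) ∧
    -- the mean vector of the bin counts, and consistency of the sample mean
    (∀ t j, Integrable (fun ω => CoxSeries.binCounts X Rb t ω j) P ∧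
      ∫ ω, CoxSeries.binCounts X Rb t ω j ∂P = CoxSeries.nuVec P Λ Rb j) ∧
    TendstoInMeasure P (CoxSeries.nuHat (CoxSeries.binCounts X Rb)) atTop
      (fun _ => CoxSeries.nuVec P Λ Rb) ∧
    -- consistency of the sample second-moment matrices
    (∀ k, TendstoInMeasure P (CoxSeries.CHat (CoxSeries.binCounts X Rb) k) atTop
      (fun _ => CoxSeries.CMat P Λ Rb k)) := by
  have hBR (j : Fin d) : Rb j ⊆ R := hunion ▸ Set.subset_iUnion Rb j
  have hR : MeasurableSet R := hunion ▸ MeasurableSet.iUnion hRbm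
  have h1 (j : Fin d) := hA1.tendstoInMeasure_factorialMonomial hA2 hRS hR hRb hBR hRbm hdisj
    fun _ : Unit => (0, j)
  simp only [CoxSeries.factorialMonomial_single, Finset.univ_unique, Finset.prod_singleton] at h1
  have h2 (k : ℕ) (j j' : Fin d) := hA1.tendstoInMeasure_factorialMonomial hA2 hRS hR hRb hBR hRbm
    hdisj ![(0, j), (k, j')]
  simp only [CoxSeries.factorialMonomial_pair, Fin.prod_univ_two, Matrix.cons_val_zero,
    Matrix.cons_val_one] at h2
  have hnu (j : Fin d) := hA1.integrableOn_nu_and_integral hRS hR (hRbm j) (hBR j) (h1 j).1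
  have hc (k : ℕ) (j j' : Fin d) := hA1.integrableOn_c_and_integral hRS hR (hRbm j) (hBR j)
    (hRbm j') (hBR j') k (h2 k j j').1
  refine ⟨fun t s hs => hA1.integrable_and_integral_eq_nu t hs,
    fun t k s hs s' hs' => hA1.integrable_and_integral_eq_c t k hs hs', fun j => (hnu j).1,
    fun k j j' => (hc k j j').1, fun t j => ⟨(h1 j).2.1 t, ?_⟩, ?_, fun k => ?_⟩
  · exact ((h1 j).2.2.1 t).trans (hnu j).2.symm
  · refine tendstoInMeasure_pi fun j => ?_
    have h := (h1 j).2.2.2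
    rw [← (hnu j).2] at h
    refine h.congr_left fun n => Eventually.of_forall fun ω => ?_
    simp [CoxSeries.nuHat, CoxSeries.binCounts, Finset.sum_apply]
  · refine tendstoInMeasure_pi fun j => tendstoInMeasure_pi fun j' => ?_
    have h := (h2 k j j').2.2.2
    rw [← (hc k j j').2] at h
    -- The lag `k` estimator averages `n - k` terms, so the law of large numbers is read along `n -
    -- k`.
    refine (h.comp (tendsto_sub_atTop_nat k)).congr_left fun n => Eventually.of_forall fun ω => ?_
    simp only [Function.comp_apply, CoxSeries.CHat, Matrix.sub_apply, Matrix.smul_apply,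
      Matrix.sum_apply, Matrix.vecMulVec_apply, CoxSeries.binCounts, smul_eq_mul,
      Finset.sum_sub_distrib, mul_sub]
    congr 1
    -- Only at lag `0` on the diagonal does the monomial subtract the count; there both averages run
    -- over the same `n` terms, so the subtraction is the entry of `nuHat`.
    by_cases hk : k = 0
    · subst hk
      by_cases hj : j = j'
      · subst hj
        simp [CoxSeries.nuHat, CoxSeries.binCounts, Finset.sum_apply]
      · simp [hj]
    · simp [hk]
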